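/- **Theorem.** Identify $\mathbb R^2$ with $\mathbb C$ and write $u\cdot v=\mathrm{Re}(u^*v)$, where $^*$ is complex conjugation. Let $M\ge 2$, $a>0$, $\mu\in\mathbb R$, $g_0,\dots,g_{M-1}\in\mathbb R\setminus\{0\}$ and $0=\theta_0<\theta_1<\dots<\theta_{M-1}<2\pi$. For $0\le m\le M-1$ let $\Sigma_m$ be the logarithmic spiral parametrized by $Z_m(s)=e^{a(s-\theta_m)}e^{is}$, $s\in\mathbb R$, let $\vec\tau=Z_m'/|Z_m'|$ and $\vec n=-i\vec\tau$ be its unit tangent and normal vectors, and let $\gamma_m$ be the density on $\Sigma_m$ given by $$\gamma_m(Z_m(s))=\frac{\partial_s\big(g_me^{2a(s-\theta_m)}\big)}{|Z_m'(s)|}=\frac{2ag_m}{\sqrt{1+a^2}}\,e^{a(s-\theta_m)} .$$ Put $\mathcal R_F=\mathbb C\setminus(\Sigma_0\cup\dots\cup\Sigma_{M-1}\cup\{0\})$ and $A=-2ai/(a+i)$, and for $r>0$, $\theta\in\mathbb R$ let $$J(r,\theta,l)=\min\{j\in\mathbb Z \mid a(2\pi j+\theta_l-\theta)+\ln r>0\}.$$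 Let $w$ be a locally integrable vector field on $\mathbb R^2$, continuous on $\mathcal R_F$, such that 1. $\mathrm{div}\,w=0$ and $\mathrm{curl}\,w=\sum_{k=0}^{M-1}\gamma_k\delta_{\Sigma_k}$ in the sense of distributions on $\mathbb R^2$, where $\delta_{\Sigma_k}$ is the arclength measure on $\Sigma_k$; 2. $|w(z)|\lesssim|z|$ as $z\to0$, $z\in\mathcal R_F$; 3. the velocity matching condition $\vec n(\zeta)\cdot(w(\zeta)-\mu\zeta)=0$ holds for $\zeta\in\Sigma_m$, $0\le m\le M-1$, where $\vec n(\zeta)\cdot w(\zeta)$ denotes the limit of $\vec n(\zeta)\cdot w(z)$ as $z\to\zeta$, $z\in\mathcal R_F$. Suppose that the parameters satisfy the discrete system $$\frac1{\sinh(\pi A)}\sum_{k=0}^{M-1}\mathcal A_{mk}g_k=-\frac{a^2+1-2\mu+2a\mu i}{2a^2},\qquad 0\le m\le M-1,$$ where $\mathcal A_{mk}=e^{A(\theta_k-\theta_m)}e^{-\pi A}$ for $k>m$, $\mathcal A_{mm}=\cosh(\pi A)$, and $\mathcal A_{mk}=e^{A(\theta_k-\theta_m)}e^{\pi A}$ for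 $k<m$. Then for all $r>0$ and $\theta\in\mathbb R$ with $z=re^{i\theta}\in\mathcal R_F$, $$w(z)=e^{i\theta}\sum_{l=0}^{M-1}\frac{2ag_l}{r(a-i)}\left(r^{\frac{2a}{a+i}}e^{A(\theta_l-\theta)}\frac{e^{2\pi J(r,\theta,l)A}}{1-e^{2\pi A}}\right)^* .$$ Moreover, $w$ has a complex potential on $\mathcal R_F$, that is, a function $\Phi$ with $\Phi'=w^*$ on $\mathcal R_F$, such that $\Phi(z)\to0$ as $z\to0$, $z\in\mathcal R_F$ (a normalization of the additive constants), and every such potential is given by $$\Phi(z)=\sum_{l=0}^{M-1}\frac{g_le^{\theta_lA}}{1-e^{2\pi A}}\,e^{iA(\ln r+i(\theta-2\pi J(r,\theta,l)))},\qquad z=re^{i\theta}\in\mathcal R_F .$$ -/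

import Mathlib

open MeasureTheory Filter Topology
open scoped ContDiff

namespace LogSpirals

/-! The plane `ℝ²` is identified with `ℂ`; the dot product of vectors `u v : ℂ` is `inner ℝ u v`. -/

/-- The parametrization `Z(s) = e^{a (s - ϑ)} e^{i s}` of the logarithmic spiral with phase `ϑ`. -/
noncomputable def spiralCurve (a ϑ : ℝ) (s : ℝ) : ℂ :=
  (Real.exp (a * (s - ϑ)) : ℂ) * Complex.exp (s * Complex.I)

/-- The circulation `Γ(s) = g e^{2 a (s - ϑ)}` along the spiral with phase `ϑ`. -/
noncomputable def circulation (a g ϑ : ℝ) (s : ℝ) : ℝ :=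
  g * Real.exp (2 * a * (s - ϑ))

/-- The vortex sheet density `γ = ∂Γ / |∂Z|` at the point `Z(s)` of the spiral. -/
noncomputable def sheetDensity (a g ϑ : ℝ) (s : ℝ) : ℝ :=
  deriv (circulation a g ϑ) s / ‖deriv (spiralCurve a ϑ) s‖

/-- The unit tangent vector at the point `Z(s)` of the spiral. -/
noncomputable def unitTangent (a ϑ : ℝ) (s : ℝ) : ℂ :=
  deriv (spiralCurve a ϑ) s / (‖deriv (spiralCurve a ϑ) s‖ : ℂ)

/-- The unit normal vector `n = -i τ` at the point `Z(s)` of the spiral. -/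
noncomputable def unitNormal (a ϑ : ℝ) (s : ℝ) : ℂ :=
  -Complex.I * unitTangent a ϑ s

/-- The complement `ℂ \ (Σ₀ ∪ … ∪ Σ_{M-1} ∪ {0})` of the family of spirals with phases `ϑ m`. -/
def spiralComplement {M : ℕ} (a : ℝ) (ϑ : Fin M → ℝ) : Set ℂ :=
  ((⋃ m, Set.range (spiralCurve a (ϑ m))) ∪ {0})ᶜ

/-- `w` is divergence free in the sense of distributions on `ℝ²`: `∫ w · ∇φ = 0` for every test
function `φ`. -/
def WeaklyDivFree (w : ℂ → ℂ) : Prop :=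
  ∀ φ : ℂ → ℝ, ContDiff ℝ ∞ φ → HasCompactSupport φ →
    ∫ z : ℂ, ((w z).re * fderiv ℝ φ z 1 + (w z).im * fderiv ℝ φ z Complex.I) = 0

/-- `curl w = ∂₁ w₂ - ∂₂ w₁ = ∑ₘ γₘ δ_{Σₘ}` in the sense of distributions on `ℝ²`, where `δ_{Σₘ}` is
the arclength measure on the `m`-th spiral: for every test function `φ`,
`-∫ (w₂ ∂₁φ - w₁ ∂₂φ) = ∑ₘ ∫_{Σₘ} φ γₘ dσ`. -/
def WeakCurlEqSpiralSheets {M : ℕ} (a : ℝ) (g ϑ : Fin M → ℝ) (w : ℂ → ℂ) : Prop :=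
  ∀ φ : ℂ → ℝ, ContDiff ℝ ∞ φ → HasCompactSupport φ →
    -∫ z : ℂ, ((w z).im * fderiv ℝ φ z 1 - (w z).re * fderiv ℝ φ z Complex.I) =
      ∑ m, ∫ s : ℝ, φ (spiralCurve a (ϑ m) s) * sheetDensity a (g m) (ϑ m) s *
        ‖deriv (spiralCurve a (ϑ m)) s‖

/-- The velocity matching condition `n(ζ) · (w(ζ) - μ ζ) = 0` on every spiral. The normal component
`n(ζ) · w(ζ)` on a spiral means the limit of `n(ζ) · w(z)` as `z → ζ` off the spirals (that is, the
common value of the limits from the two sides). -/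
def VelocityMatching {M : ℕ} (a μ : ℝ) (ϑ : Fin M → ℝ) (w : ℂ → ℂ) : Prop :=
  ∀ (m : Fin M) (s : ℝ),
    Tendsto (fun z => inner ℝ (unitNormal a (ϑ m) s) (w z))
      (𝓝[spiralComplement a ϑ] (spiralCurve a (ϑ m) s))
      (𝓝 (inner ℝ (unitNormal a (ϑ m) s) ((μ : ℂ) * spiralCurve a (ϑ m) s)))

/-- The decay `|w(z)| ≲ |z|` as `z → 0` off the spirals. -/
def DecayAtOrigin {M : ℕ} (a : ℝ) (ϑ : Fin M → ℝ) (w : ℂ → ℂ) : Prop :=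
  ∃ C : ℝ, ∀ᶠ z in 𝓝[spiralComplement a ϑ] (0 : ℂ), ‖w z‖ ≤ C * ‖z‖

/-- The constant `A = -2 a i / (a + i)`. -/
noncomputable def constA (a : ℝ) : ℂ :=
  -2 * a * Complex.I / (a + Complex.I)

/-- The coefficients `𝒜ₘₖ` of the discrete system. -/
noncomputable def coeffA {M : ℕ} (a : ℝ) (ϑ : Fin M → ℝ) (m k : Fin M) : ℂ :=
  Complex.exp (constA a * (ϑ k - ϑ m)) *
    if m < k then Complex.exp (-(Real.pi * constA a))
    else if k = m then Complex.cosh (Real.pi * constA a)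
    else Complex.exp (Real.pi * constA a)

/-- The discrete system of equations for the parameters of the spirals. -/
def DiscreteSystem {M : ℕ} (a μ : ℝ) (g ϑ : Fin M → ℝ) : Prop :=
  ∀ m : Fin M,
    1 / Complex.sinh (Real.pi * constA a) * ∑ k, coeffA a ϑ m k * (g k : ℂ) =
      -((a : ℂ) ^ 2 + 1 - 2 * μ + 2 * a * μ * Complex.I) / (2 * (a : ℂ) ^ 2)

/-- The winding number `J(r, θ) = min {j ∈ ℤ | a (2 π j + ϑ - θ) + ln r > 0}` with respect to the
spiral with phase `ϑ`. -/
noncomputable def windingNumber (a ϑ r θ : ℝ) : ℤ :=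
  sInf {j : ℤ | 0 < a * (2 * Real.pi * j + ϑ - θ) + Real.log r}

/-- The explicit expression for the complex potential at the point `r e^{iθ}`. -/
noncomputable def potentialFormula {M : ℕ} (a : ℝ) (g ϑ : Fin M → ℝ) (r θ : ℝ) : ℂ :=
  ∑ l, (g l : ℂ) * Complex.exp (ϑ l * constA a) / (1 - Complex.exp (2 * Real.pi * constA a)) *
    Complex.exp (Complex.I * constA a *
      (Real.log r + Complex.I * (θ - 2 * Real.pi * windingNumber a (ϑ l) r θ)))

/-- The explicit expression for the velocity at the point `r e^{iθ}`. -/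
noncomputable def velocityFormula {M : ℕ} (a : ℝ) (g ϑ : Fin M → ℝ) (r θ : ℝ) : ℂ :=
  Complex.exp (θ * Complex.I) *
    ∑ l, 2 * (a : ℂ) * (g l : ℂ) / ((r : ℂ) * (a - Complex.I)) *
      (starRingEnd ℂ) ((r : ℂ) ^ (2 * (a : ℂ) / (a + Complex.I)) *
        Complex.exp (constA a * (ϑ l - θ)) *
        (Complex.exp (2 * Real.pi * windingNumber a (ϑ l) r θ * constA a) /
          (1 - Complex.exp (2 * Real.pi * constA a))))

/-- `Φ` is a complex potential of the velocity field `w` off the spirals: `Φ' = w*`, where `*` is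
complex conjugation. -/
def IsComplexPotential {M : ℕ} (a : ℝ) (ϑ : Fin M → ℝ) (w Φ : ℂ → ℂ) : Prop :=
  ∀ z ∈ spiralComplement a ϑ, HasDerivAt Φ ((starRingEnd ℂ) (w z)) z

end LogSpirals

/-! The equations for div and curl combine into one: tested against `φ`, the conjugate field `w*`
solves the weak Cauchy-Riemann equation whose source is the sheet density on the spirals. The
explicit conjugate velocity `conjVelocity`, a combination of powers `z ^ (i A) / z` cut along the
spirals, solves the same equation: in logarithmic coordinates the plane is a strip bounded by two
copies of one spiral, and the integrand is a total derivative whose boundary terms combine to the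
sheet density (`integral_spiralPow_div_mul`, `integral_conjVelocity_mul`). By Weyl's lemma
(`WeaklyHolomorphic.exists_entire`) the difference is, off the spirals, an entire function `H`.

To see that `H = 0`, use the group `z ↦ exp ((a + i) t) z`, which slides every spiral along itself.
Since `i A (a + i) = 2 a` is real, the explicit velocity only scales and rotates with the tangent
under this group. Its normal component on a spiral is therefore a constant times `e^{a s}`; so is
the normal component prescribed by the matching condition, hence also that of `H`. But if `H` had a
leading term `c z ^ n` at the origin, its normal component would oscillate like `e^{i (n + 1) s}`
and change sign, which a multiple of `e^{a s}` cannot do (`eq_zero_of_normal_component`).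

Integrating the velocity gives the potential. Two potentials vanishing at the origin agree, since
their difference is constant on each orbit of the group and every orbit tends to `0` backwards in
time. -/

namespace LogSpirals

/-! ### Weyl's lemma for the Cauchy-Riemann operator -/

/-- A smooth cutoff on the line, equal to `1` on `(-∞, 1/2]` and to `0` on `[1, ∞)`. -/
noncomputable def cutoff (t : ℝ) : ℝ := Real.smoothTransition (2 - 2 * t)

lemma contDiff_cutoff : ContDiff ℝ ∞ cutoff := by
  unfold cutoff
  exact Real.smoothTransition.contDiff.comp (by fun_prop)

lemma cutoff_of_le {t : ℝ} (h : t ≤ 1 / 2) : cutoff t = 1 :=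
  Real.smoothTransition.one_of_one_le (by linarith)

lemma cutoff_of_ge {t : ℝ} (h : 1 ≤ t) : cutoff t = 0 :=
  Real.smoothTransition.zero_of_nonpos (by linarith)

lemma antitone_cutoff : Antitone cutoff := fun _ _ h =>
  Real.smoothTransition.monotone (by linarith)

/-- A nonnegative smooth profile supported in `[1/2, 1]`. -/
noncomputable def profile (t : ℝ) : ℝ := -2 * deriv cutoff t

lemma contDiff_profile : ContDiff ℝ ∞ profile :=
  contDiff_const.mul ((contDiff_infty_iff_deriv.1 contDiff_cutoff).2)

lemma profile_nonneg (t : ℝ) : 0 ≤ profile t := by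
  have := antitone_cutoff.deriv_nonpos (x := t)
  unfold profile; linarith

lemma profile_of_gt {t : ℝ} (h : 1 < t) : profile t = 0 := by
  have : cutoff =ᶠ[𝓝 t] fun _ => 0 := by
    filter_upwards [lt_mem_nhds h] with s hs using cutoff_of_ge hs.le
  simp [profile, this.deriv_eq]

lemma profile_of_lt {t : ℝ} (h : t < 1 / 2) : profile t = 0 := by
  have : cutoff =ᶠ[𝓝 t] fun _ => 1 := by
    filter_upwards [gt_mem_nhds h] with s hs using cutoff_of_le hs.le
  simp [profile, this.deriv_eq]

lemma exists_profile_ne_zero : ∃ t, 0 < t ∧ profile t ≠ 0 := by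
  obtain ⟨t, ht, h⟩ := exists_deriv_eq_slope cutoff (a := 1 / 2) (b := 1) (by norm_num)
    contDiff_cutoff.continuous.continuousOn
    (contDiff_cutoff.differentiable (by simp)).differentiableOn
  refine ⟨t, by linarith [ht.1], ?_⟩
  rw [profile, h, cutoff_of_le le_rfl, cutoff_of_ge le_rfl]
  norm_num

/-- A radial mollifier on the plane. -/
noncomputable def mollifier (z : ℂ) : ℝ := profile (Complex.normSq z)

lemma contDiff_normSq : ContDiff ℝ ∞ (fun z : ℂ => Complex.normSq z) := by
  simp only [Complex.normSq_apply]
  have h1 : ContDiff ℝ ∞ (fun z : ℂ => z.re) := Complex.reCLM.contDiff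
  have h2 : ContDiff ℝ ∞ (fun z : ℂ => z.im) := Complex.imCLM.contDiff
  exact (h1.mul h1).add (h2.mul h2)

lemma hasCompactSupport_of_normSq {E : Type*} [Zero E] {f : ℂ → E} {R : ℝ}
    (h : ∀ z, R < Complex.normSq z → f z = 0) : HasCompactSupport f := by
  refine HasCompactSupport.intro (isCompact_closedBall (0 : ℂ) (|R| + 1)) fun z hz => h z ?_
  rw [Metric.mem_closedBall, dist_zero_right, not_le] at hz
  rw [Complex.normSq_eq_norm_sq]
  nlinarith [abs_nonneg R, le_abs_self R]

lemma contDiff_mollifier : ContDiff ℝ ∞ mollifier := contDiff_profile.comp contDiff_normSq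

lemma hasCompactSupport_mollifier : HasCompactSupport mollifier :=
  hasCompactSupport_of_normSq fun _ h => profile_of_gt h

lemma mollifier_nonneg (z : ℂ) : 0 ≤ mollifier z := profile_nonneg _

lemma mollifier_neg (z : ℂ) : mollifier (-z) = mollifier z := by simp [mollifier]

lemma integral_mollifier_pos : 0 < ∫ z, mollifier z := by
  obtain ⟨t, ht, h⟩ := exists_profile_ne_zero
  refine contDiff_mollifier.continuous.integral_pos_of_hasCompactSupport_nonneg_nonzero
    hasCompactSupport_mollifier mollifier_nonneg (x := (Real.sqrt t : ℂ)) ?_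
  simpa [mollifier, Complex.normSq_ofReal, Real.mul_self_sqrt ht.le] using h

/-- The (real) directional derivatives of `f` combined into twice the Wirtinger derivative
`∂f/∂z̄`. -/
noncomputable def dbar (f : ℂ → ℂ) (z : ℂ) : ℂ :=
  fderiv ℝ f z 1 + Complex.I * fderiv ℝ f z Complex.I

/-- `h` solves the Cauchy-Riemann equation in the sense of distributions. -/
def WeaklyHolomorphic (h : ℂ → ℂ) : Prop :=
  ∀ φ : ℂ → ℝ, ContDiff ℝ ∞ φ → HasCompactSupport φ →
    ∫ z, h z * ((fderiv ℝ φ z 1 : ℂ) + Complex.I * (fderiv ℝ φ z Complex.I : ℂ)) = 0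

lemma integrable_mul_of_hasCompactSupport {h f : ℂ → ℂ} (hh : LocallyIntegrable h)
    (hf : Continuous f) (hfc : HasCompactSupport f) : Integrable (fun z => h z * f z) := by
  simpa [mul_comm] using hh.integrable_smul_left_of_hasCompactSupport hf hfc

lemma integrable_mul_fderiv {h : ℂ → ℂ} (hh : LocallyIntegrable h) {φ : ℂ → ℝ}
    (hφ : ContDiff ℝ ∞ φ) (hφc : HasCompactSupport φ) :
    Integrable
      (fun z => h z * ((fderiv ℝ φ z 1 : ℂ) + Complex.I * (fderiv ℝ φ z Complex.I : ℂ))) := by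
  have hc := hφ.continuous_fderiv (by simp)
  refine integrable_mul_of_hasCompactSupport hh ?_ ?_
  · fun_prop
  · refine (hφc.fderiv ℝ).mono fun z hz h0 => hz ?_
    simp [Function.notMem_support.1 (show z ∉ Function.support (fderiv ℝ φ) from fun h => h h0)]

/-- Splitting into real and imaginary parts admits complex test functions, such as the truncated
Cauchy kernel. -/
lemma WeaklyHolomorphic.integral_mul_dbar {h : ℂ → ℂ} (hw : WeaklyHolomorphic h)
    (hh : LocallyIntegrable h) {ψ : ℂ → ℂ} (hψ : ContDiff ℝ ∞ ψ) (hψc : HasCompactSupport ψ) :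
    ∫ z, h z * dbar ψ z = 0 := by
  have hre : ContDiff ℝ ∞ (fun z => (ψ z).re) := Complex.reCLM.contDiff.comp hψ
  have him : ContDiff ℝ ∞ (fun z => (ψ z).im) := Complex.imCLM.contDiff.comp hψ
  have hrec : HasCompactSupport (fun z => (ψ z).re) := hψc.comp_left (g := Complex.re) rfl
  have himc : HasCompactSupport (fun z => (ψ z).im) := hψc.comp_left (g := Complex.im) rfl
  have hd : ∀ z v, fderiv ℝ ψ z v = (fderiv ℝ (fun z => (ψ z).re) z v : ℂ) +
      Complex.I * (fderiv ℝ (fun z => (ψ z).im) z v : ℂ) := by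
    intro z v
    have h := (hψ.differentiable (by simp) z).hasFDerivAt
    have h1 := (Complex.reCLM.hasFDerivAt (x := ψ z)).comp z h
    have h2 := (Complex.imCLM.hasFDerivAt (x := ψ z)).comp z h
    have e1 : fderiv ℝ (fun z => (ψ z).re) z = _ := h1.fderiv
    have e2 : fderiv ℝ (fun z => (ψ z).im) z = _ := h2.fderiv
    rw [e1, e2]
    simp [mul_comm Complex.I]
  have key : ∀ z, h z * dbar ψ z =
      h z * ((fderiv ℝ (fun z => (ψ z).re) z 1 : ℂ) +
        Complex.I * (fderiv ℝ (fun z => (ψ z).re) z Complex.I : ℂ)) + Complex.I *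
      (h z * ((fderiv ℝ (fun z => (ψ z).im) z 1 : ℂ) +
        Complex.I * (fderiv ℝ (fun z => (ψ z).im) z Complex.I : ℂ))) := by
    intro z
    rw [dbar, hd, hd]; ring
  simp_rw [key]
  rw [integral_add (integrable_mul_fderiv hh hre hrec)
    ((integrable_mul_fderiv hh him himc).const_mul _), integral_const_mul, hw _ hre hrec,
    hw _ him himc]
  simp

/-- Difference of two truncations of the Cauchy kernel `1 / z`. -/
noncomputable def truncatedKernel (k : ℝ) (z : ℂ) : ℂ :=
  ((cutoff (k * Complex.normSq z) - cutoff (Complex.normSq z) : ℝ) : ℂ) * z⁻¹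

/-- Both cutoffs equal `1` near the origin and cancel, which removes the pole of `1 / z`. -/
lemma truncatedKernel_eventuallyEq (k : ℝ) : truncatedKernel k =ᶠ[𝓝 0] fun _ => 0 := by
  have h1 : ∀ᶠ z : ℂ in 𝓝 0, k * Complex.normSq z < 1 / 2 := by
    have : Continuous fun z : ℂ => k * Complex.normSq z := by fun_prop
    exact this.continuousAt.eventually_lt continuousAt_const (by simp)
  have h2 : ∀ᶠ z : ℂ in 𝓝 0, Complex.normSq z < 1 / 2 :=
    Complex.continuous_normSq.continuousAt.eventually_lt continuousAt_const (by simp)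
  filter_upwards [h1, h2] with z hz1 hz2
  simp [truncatedKernel, cutoff_of_le hz1.le, cutoff_of_le hz2.le]

lemma contDiff_truncatedKernel (k : ℝ) : ContDiff ℝ ∞ (truncatedKernel k) := by
  rw [contDiff_iff_contDiffAt]
  intro z
  rcases eq_or_ne z 0 with rfl | hz
  · exact contDiffAt_const.congr_of_eventuallyEq (truncatedKernel_eventuallyEq k)
  · unfold truncatedKernel
    refine ContDiffAt.mul ?_ (contDiffAt_inv ℝ hz)
    refine Complex.ofRealCLM.contDiff.contDiffAt.comp z (ContDiff.contDiffAt ?_)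
    exact (contDiff_cutoff.comp (contDiff_const.mul contDiff_normSq)).sub
      (contDiff_cutoff.comp contDiff_normSq)

lemma hasCompactSupport_truncatedKernel {k : ℝ} (hk : 0 < k) :
    HasCompactSupport (truncatedKernel k) := by
  refine hasCompactSupport_of_normSq (R := max 1 k⁻¹) fun z hz => ?_
  rw [max_lt_iff, inv_lt_iff_one_lt_mul₀' hk] at hz
  simp [truncatedKernel, cutoff_of_ge hz.1.le, cutoff_of_ge hz.2.le]

lemma hasFDerivAt_normSq (z : ℂ) : HasFDerivAt (fun z : ℂ => Complex.normSq z)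
    ((2 * z.re) • Complex.reCLM + (2 * z.im) • Complex.imCLM) z := by
  have h1 : HasFDerivAt (fun z : ℂ => z.re) Complex.reCLM z := Complex.reCLM.hasFDerivAt
  have h2 : HasFDerivAt (fun z : ℂ => z.im) Complex.imCLM z := Complex.imCLM.hasFDerivAt
  have h := (h1.mul h1).add (h2.mul h2)
  simp only [Complex.normSq_apply]
  refine h.congr_fderiv ?_
  ext
  simp
  ring

/-- Away from `0` the factor `1 / z` is holomorphic, so only the cutoffs are differentiated; the
operator maps `|z|²` to `2 z`, and this `z` cancels the kernel. The outcome is a difference of two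
mollifiers at different scales. -/
lemma dbar_truncatedKernel (k : ℝ) (z : ℂ) :
    dbar (truncatedKernel k) z =
      ((profile (Complex.normSq z) - k * profile (k * Complex.normSq z) : ℝ) : ℂ) := by
  rcases eq_or_ne z 0 with rfl | hz
  · simp [dbar, (truncatedKernel_eventuallyEq k).fderiv_eq,
      profile_of_lt (show (0 : ℝ) < 1 / 2 by norm_num)]
  · have hχ : ∀ t, HasDerivAt cutoff (deriv cutoff t) t := fun t =>
      (contDiff_cutoff.differentiable (by simp) t).hasDerivAt
    have hn := hasFDerivAt_normSq z
    have hu := ((hχ _).comp_hasFDerivAt z (hn.const_mul k)).sub ((hχ _).comp_hasFDerivAt z hn)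
    have hu' := (Complex.ofRealCLM.hasFDerivAt).comp z hu
    have hi : HasFDerivAt (fun z : ℂ => z⁻¹) _ z :=
      (hasDerivAt_inv hz).hasFDerivAt.restrictScalars ℝ
    have h := hu'.mul hi
    have e : fderiv ℝ (truncatedKernel k) z = _ := h.fderiv
    rw [dbar, e]
    have hz' : z * z⁻¹ = 1 := mul_inv_cancel₀ hz
    simp [profile]
    have hzz : (z.re : ℂ) + Complex.I * z.im = z := by rw [mul_comm, Complex.re_add_im]
    linear_combination (2 * (k * ((deriv cutoff (k * Complex.normSq z) : ℝ) : ℂ) -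
      ((deriv cutoff (Complex.normSq z) : ℝ) : ℂ)) * z⁻¹) * hzz +
      (2 * (k * ((deriv cutoff (k * Complex.normSq z) : ℝ) : ℂ) -
      ((deriv cutoff (Complex.normSq z) : ℝ) : ℂ))) * hz' +
      ((-(cutoff (k * Complex.normSq z) : ℂ) +
      cutoff (Complex.normSq z)) * (z ^ 2)⁻¹) * Complex.I_sq

lemma dbar_comp_sub (f : ℂ → ℂ) (x z : ℂ) : dbar (fun y => f (y - x)) z = dbar f (z - x) := by
  simp [dbar, fderiv_comp_sub]

/-- The mean of `h` against the mollifier centred at `x`. -/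
noncomputable def mollified (h : ℂ → ℂ) (x : ℂ) : ℂ := ∫ y, h y * (mollifier (y - x) : ℂ)

/-- A weak form of the mean value property: the difference of the mollifiers at two scales is `dbar`
of a test function, so `h` has the same mean against both. -/
lemma WeaklyHolomorphic.mollified_eq {h : ℂ → ℂ} (hw : WeaklyHolomorphic h)
    (hh : LocallyIntegrable h) (x : ℂ) {R : ℝ} (hR : 0 < R) :
    Integrable (fun u : ℂ => h (x + R • u) * (mollifier u : ℂ)) ∧
      mollified h x = ∫ u : ℂ, h (x + R • u) * (mollifier u : ℂ) := by
  -- With this `k`, `k |R u|² = |u|²`, and `k` is also the Jacobian factor of the planar dilation by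
  -- `R`.
  set k : ℝ := (R ^ 2)⁻¹ with hk
  have hkpos : 0 < k := by positivity
  have hshift : ∀ {f : ℂ → ℝ}, HasCompactSupport f →
      HasCompactSupport (fun y => ((f (y - x) : ℝ) : ℂ)) := fun {f} hf =>
    (hf.comp_homeomorph (Homeomorph.subRight x)).comp_left (g := fun t : ℝ => (t : ℂ)) (by simp)
  have hcm := contDiff_mollifier.continuous
  have hcp := contDiff_profile.continuous
  have hi1 : Integrable (fun y => h y * (mollifier (y - x) : ℂ)) :=
    integrable_mul_of_hasCompactSupport hh (by fun_prop) (hshift hasCompactSupport_mollifier)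
  have hi2 : Integrable (fun y => h y * (profile (k * Complex.normSq (y - x)) : ℂ)) := by
    refine integrable_mul_of_hasCompactSupport hh (by fun_prop)
      (hshift (f := fun y => profile (k * Complex.normSq y)) ?_)
    refine hasCompactSupport_of_normSq (R := k⁻¹) fun z hz => profile_of_gt ?_
    rwa [inv_lt_iff_one_lt_mul₀' hkpos] at hz
  set F : ℂ → ℂ := fun y => h y * (profile (k * Complex.normSq (y - x)) : ℂ) with hF
  have hcomp : (fun u : ℂ => h (x + R • u) * (mollifier u : ℂ)) = fun u => F (x + R • u) := by
    ext u
    have : k * Complex.normSq (R • u) = Complex.normSq u := by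
      rw [Complex.real_smul, Complex.normSq_mul, Complex.normSq_ofReal, hk]
      field_simp
    simp only [hF, mollifier, add_sub_cancel_left, this]
  have hi3 : Integrable (fun u : ℂ => h (x + R • u) * (mollifier u : ℂ)) := by
    rw [hcomp]
    exact (hi2.comp_add_left x).comp_smul hR.ne'
  refine ⟨hi3, ?_⟩
  have h0 := hw.integral_mul_dbar hh (ψ := fun y => truncatedKernel k (y - x))
    ((contDiff_truncatedKernel k).comp (contDiff_id.sub contDiff_const))
    ((hasCompactSupport_truncatedKernel hkpos).comp_homeomorph (Homeomorph.subRight x))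
  simp_rw [dbar_comp_sub, dbar_truncatedKernel] at h0
  have h1 : ∀ y, h y * ((profile (Complex.normSq (y - x)) -
      k * profile (k * Complex.normSq (y - x)) : ℝ) : ℂ) = h y * (mollifier (y - x) : ℂ) -
      k * (h y * (profile (k * Complex.normSq (y - x)) : ℂ)) := by
    intro y
    rw [mollifier]; push_cast; ring
  simp_rw [h1] at h0
  rw [integral_sub hi1 (hi2.const_mul _), integral_const_mul, sub_eq_zero] at h0
  rw [hcomp, mollified, h0, Measure.integral_comp_smul volume (fun v => F (x + v)) R,
    integral_add_left_eq_self F x]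
  simp [Complex.finrank_real_complex, hk]

/-- The mean does not depend on the scale, so the scale may be shrunk until `h` is nearly constant
on the support of the mollifier. -/
lemma WeaklyHolomorphic.mollified_eq_of_continuousAt {h : ℂ → ℂ} (hw : WeaklyHolomorphic h)
    (hh : LocallyIntegrable h) {x : ℂ} (hx : ContinuousAt h x) :
    mollified h x = ((∫ z, mollifier z : ℝ) : ℂ) * h x := by
  set c := ∫ z, mollifier z with hc
  have hcpos : 0 < c := integral_mollifier_pos
  have him : Integrable mollifier :=
    contDiff_mollifier.continuous.integrable_of_hasCompactSupport hasCompactSupport_mollifier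
  have hsupp : ∀ u : ℂ, 1 < ‖u‖ → mollifier u = 0 := fun u hu => by
    refine profile_of_gt ?_
    rw [Complex.normSq_eq_norm_sq]
    nlinarith
  refine eq_of_forall_dist_le fun η hη => ?_
  obtain ⟨δ, hδ, hδ'⟩ := Metric.continuousAt_iff.1 hx (η / c) (by positivity)
  obtain ⟨hi, he⟩ := hw.mollified_eq hh x (R := δ / 2) (by positivity)
  have e2 : ((c : ℝ) : ℂ) * h x = ∫ u : ℂ, h x * (mollifier u : ℂ) := by
    rw [integral_const_mul, integral_complex_ofReal, mul_comm]
  have hi2 : Integrable (fun u : ℂ => h x * (mollifier u : ℂ)) := him.ofReal.const_mul _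
  rw [dist_eq_norm, he, e2, ← integral_sub hi hi2]
  have : η = ∫ u, η / c * mollifier u := by
    rw [integral_const_mul, ← hc]; field_simp
  rw [this]
  refine norm_integral_le_of_norm_le (him.const_mul _) (Eventually.of_forall fun u => ?_)
  rw [← sub_mul, norm_mul, Complex.norm_real, Real.norm_of_nonneg (mollifier_nonneg u)]
  rcases le_or_gt ‖u‖ 1 with hu | hu
  · refine mul_le_mul_of_nonneg_right ?_ (mollifier_nonneg u)
    rw [← dist_eq_norm]
    refine (hδ' ?_).le
    rw [dist_eq_norm, add_sub_cancel_left, norm_smul, Real.norm_of_nonneg (by positivity)]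
    nlinarith
  · simp [hsupp u hu]

/-- The derivatives of a convolution fall on the smooth factor, where the weak equation for `h`
turns them into the Cauchy-Riemann equations. -/
lemma WeaklyHolomorphic.differentiable_mollified {h : ℂ → ℂ} (hw : WeaklyHolomorphic h)
    (hh : LocallyIntegrable h) : Differentiable ℂ (mollified h) := by
  set m : ℂ → ℂ := fun z => (mollifier z : ℂ) with hm
  have hmd : ContDiff ℝ ∞ m := Complex.ofRealCLM.contDiff.comp contDiff_mollifier
  have hmc : HasCompactSupport m :=
    hasCompactSupport_mollifier.comp_left (g := fun t : ℝ => (t : ℂ)) (by simp)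
  have hfun : mollified h = convolution h m (ContinuousLinearMap.mul ℝ ℂ) volume := by
    ext x
    simp only [mollified, convolution_def, ContinuousLinearMap.mul_apply', hm]
    congr 1 with y
    rw [← mollifier_neg, neg_sub]
  intro x
  have hd := hmc.hasFDerivAt_convolution_right (ContinuousLinearMap.mul ℝ ℂ) hh
    (hmd.of_le (by simp)) x
  rw [← hfun] at hd
  have happ : ∀ v,
      (convolution h (fderiv ℝ m) ((ContinuousLinearMap.mul ℝ ℂ).precompR ℂ) volume) x v =
      ∫ y, h y * fderiv ℝ m (x - y) v := by
    intro v
    rw [convolution_precompR_apply _ hh (hmc.fderiv ℝ) (hmd.continuous_fderiv (by simp))]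
    rfl
  have hint : ∀ v, Integrable (fun y => h y * fderiv ℝ m (x - y) v) := by
    intro v
    have hc := hmd.continuous_fderiv (by simp)
    refine integrable_mul_of_hasCompactSupport hh (by fun_prop) ?_
    exact ((hmc.fderiv_apply (𝕜 := ℝ) v)).comp_homeomorph (Homeomorph.subLeft x)
  have h0 := hw.integral_mul_dbar hh (ψ := fun y => m (x - y))
    (hmd.comp (contDiff_const.sub contDiff_id)) (hmc.comp_homeomorph (Homeomorph.subLeft x))
  have hdb : ∀ y, dbar (fun y => m (x - y)) y =
      -(fderiv ℝ m (x - y) 1 + Complex.I * fderiv ℝ m (x - y) Complex.I) := by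
    intro y
    have := ((hmd.differentiable (by simp) (x - y)).hasFDerivAt).comp y
      ((hasFDerivAt_id y).const_sub x)
    have e : fderiv ℝ (fun y => m (x - y)) y = _ := this.fderiv
    rw [dbar, e]
    simp
    ring
  have h1 : ∫ y, h y * fderiv ℝ m (x - y) 1 +
      Complex.I * (h y * fderiv ℝ m (x - y) Complex.I) = 0 := by
    rw [← neg_eq_zero, ← integral_neg, ← h0]
    congr 1 with y
    rw [hdb]; ring
  rw [integral_add (hint 1) ((hint Complex.I).const_mul _), integral_const_mul] at h1
  refine (HasFDerivAt.complexOfReal_hasFDerivAt hd ?_).differentiableAt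
  rw [happ, happ, smul_eq_mul]
  linear_combination (-Complex.I) * h1 + (∫ y, h y * fderiv ℝ m (x - y) Complex.I) * Complex.I_sq

/-- Weyl's lemma: a locally integrable distributional solution of the Cauchy-Riemann equation
agrees with an entire function at its points of continuity. -/
theorem WeaklyHolomorphic.exists_entire {h : ℂ → ℂ} (hw : WeaklyHolomorphic h)
    (hh : LocallyIntegrable h) :
    ∃ H : ℂ → ℂ, Differentiable ℂ H ∧ ∀ x, ContinuousAt h x → h x = H x := by
  refine ⟨fun x => ((∫ z, mollifier z : ℝ) : ℂ)⁻¹ * mollified h x,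
    (hw.differentiable_mollified hh).const_mul _, fun x hx => ?_⟩
  have : ((∫ z, mollifier z : ℝ) : ℂ) ≠ 0 := by
    exact_mod_cast integral_mollifier_pos.ne'
  simp only [hw.mollified_eq_of_continuousAt hh hx]
  field_simp

/-! ### The logarithm cut along a logarithmic spiral -/

/-- The signed horizontal distance of `ζ` to the line `{a (s - ϑ) + i s}`, which `exp` maps to the
spiral with phase `ϑ`. -/
def offset (a ϑ : ℝ) (ζ : ℂ) : ℝ := ζ.re - a * (ζ.im - ϑ)

/-- The branch of the logarithm cut along the spiral with phase `ϑ`. -/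
noncomputable def spiralLog (a ϑ : ℝ) (z : ℂ) : ℂ :=
  Real.log ‖z‖ + Complex.I * (z.arg - 2 * Real.pi * windingNumber a ϑ ‖z‖ z.arg)

lemma continuous_offset (a ϑ : ℝ) : Continuous (offset a ϑ) := by
  unfold offset; fun_prop

/-- The strict inequality in the definition of the winding number makes the minimum a floor plus
one. For the same reason the strip in `offset_spiralLog_mem` is open at `0` and closed at `2πa`: the
spiral is its right edge. -/
lemma windingNumber_eq_floor {a : ℝ} (ha : 0 < a) (ϑ r θ : ℝ) :
    windingNumber a ϑ r θ = ⌊(θ - ϑ - Real.log r / a) / (2 * Real.pi)⌋ + 1 := by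
  have hπ := Real.pi_pos
  have : {j : ℤ | 0 < a * (2 * Real.pi * j + ϑ - θ) + Real.log r} =
      Set.Ici (⌊(θ - ϑ - Real.log r / a) / (2 * Real.pi)⌋ + 1) := by
    ext j
    rw [Set.mem_ofPred_eq, Set.mem_Ici, Int.add_one_le_iff, Int.floor_lt,
      div_lt_iff₀ (by positivity)]
    have e : a * (2 * Real.pi * j + ϑ - θ) + Real.log r =
        a * (j * (2 * Real.pi) - (θ - ϑ - Real.log r / a)) := by field_simp; ring
    rw [e, mul_pos_iff_of_pos_left ha, sub_pos]
  rw [windingNumber, this, csInf_Ici]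

lemma windingNumber_add_int {a : ℝ} (ha : 0 < a) (ϑ r θ : ℝ) (n : ℤ) :
    windingNumber a ϑ r (θ + n * (2 * Real.pi)) = windingNumber a ϑ r θ + n := by
  have hπ := Real.pi_pos
  rw [windingNumber_eq_floor ha, windingNumber_eq_floor ha]
  have : (θ + n * (2 * Real.pi) - ϑ - Real.log r / a) / (2 * Real.pi) =
    (θ - ϑ - Real.log r / a) / (2 * Real.pi) + n := by field_simp; ring
  rw [this, Int.floor_add_intCast]; ring

/-- Changing the argument by full turns changes the winding number by the same number of turns, so
any choice of `θ` gives the same value. -/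
lemma spiralLog_polar {a : ℝ} (ha : 0 < a) (ϑ : ℝ) {r : ℝ} (hr : 0 < r) (θ : ℝ) :
    spiralLog a ϑ (r * Complex.exp (θ * Complex.I)) =
      Real.log r + Complex.I * (θ - 2 * Real.pi * windingNumber a ϑ r θ) := by
  set z : ℂ := r * Complex.exp (θ * Complex.I) with hz
  have hn : ‖z‖ = r := by
    rw [hz, norm_mul, Complex.norm_exp_ofReal_mul_I, Complex.norm_real, Real.norm_of_nonneg hr.le,
      mul_one]
  have h1 := Complex.norm_mul_exp_arg_mul_I z
  rw [hn, hz, mul_right_inj' (by exact_mod_cast hr.ne'), Complex.exp_eq_exp_iff_exists_int] at h1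
  obtain ⟨n, hn'⟩ := h1
  have harg : z.arg = θ + n * (2 * Real.pi) := by
    have : (z.arg : ℂ) = ((θ + n * (2 * Real.pi) : ℝ) : ℂ) := by
      rw [← mul_left_inj' Complex.I_ne_zero]
      push_cast
      rw [hn']; ring
    exact_mod_cast this
  rw [spiralLog, hn, harg, windingNumber_add_int ha]
  push_cast; ring

lemma exp_eq_polar (ζ : ℂ) :
    Complex.exp ζ = (Real.exp ζ.re : ℂ) * Complex.exp (ζ.im * Complex.I) := by
  rw [Complex.ofReal_exp, ← Complex.exp_add, Complex.re_add_im]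

lemma spiralLog_exp {a ϑ : ℝ} (ha : 0 < a) {ζ : ℂ}
    (hζ : offset a ϑ ζ ∈ Set.Ioc 0 (2 * Real.pi * a)) : spiralLog a ϑ (Complex.exp ζ) = ζ := by
  have hπ := Real.pi_pos
  rw [exp_eq_polar, spiralLog_polar ha ϑ (Real.exp_pos _), windingNumber_eq_floor ha, Real.log_exp]
  have : ⌊(ζ.im - ϑ - ζ.re / a) / (2 * Real.pi)⌋ = -1 := by
    have e : (ζ.im - ϑ - ζ.re / a) / (2 * Real.pi) = -(offset a ϑ ζ / (2 * Real.pi * a)) := by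
      rw [offset]; field_simp; ring
    have h1 : 0 < offset a ϑ ζ / (2 * Real.pi * a) := div_pos hζ.1 (by positivity)
    have h2 : offset a ϑ ζ / (2 * Real.pi * a) ≤ 1 := (div_le_one (by positivity)).2 hζ.2
    rw [e, Int.floor_eq_iff]
    push_cast
    constructor <;> linarith
  rw [this]
  push_cast
  rw [mul_comm Complex.I]
  simp [Complex.re_add_im]

lemma exp_spiralLog {a ϑ : ℝ} {z : ℂ} (hz : z ≠ 0) :
    Complex.exp (spiralLog a ϑ z) = z := by
  have : spiralLog a ϑ z = (Real.log ‖z‖ : ℂ) + z.arg * Complex.I -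
      windingNumber a ϑ ‖z‖ z.arg * (2 * Real.pi * Complex.I) := by
    rw [spiralLog]; ring
  rw [this, Complex.exp_sub, Complex.exp_int_mul_two_pi_mul_I, div_one, Complex.exp_add,
    ← Complex.ofReal_exp, Real.exp_log (norm_pos_iff.2 hz), Complex.norm_mul_exp_arg_mul_I]

lemma offset_spiralLog_mem {a : ℝ} (ha : 0 < a) (ϑ : ℝ) (z : ℂ) :
    offset a ϑ (spiralLog a ϑ z) ∈ Set.Ioc 0 (2 * Real.pi * a) := by
  have hπ := Real.pi_pos
  have hre : (spiralLog a ϑ z).re = Real.log ‖z‖ := by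
    simp [spiralLog]
  have him : (spiralLog a ϑ z).im = z.arg - 2 * Real.pi * windingNumber a ϑ ‖z‖ z.arg := by
    simp [spiralLog]
  rw [offset, hre, him, windingNumber_eq_floor ha]
  set x := (z.arg - ϑ - Real.log ‖z‖ / a) / (2 * Real.pi) with hx
  have e : Real.log ‖z‖ - a * (z.arg - 2 * Real.pi * ((⌊x⌋ + 1 : ℤ) : ℝ) - ϑ) =
      2 * Real.pi * a * (⌊x⌋ + 1 - x) := by
    rw [hx]; push_cast; field_simp; ring
  rw [e]
  have h1 := Int.floor_le x
  have h2 := Int.lt_floor_add_one x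
  have : 0 < 2 * Real.pi * a := by positivity
  constructor
  · apply mul_pos this; linarith
  · nlinarith

lemma measurable_spiralLog {a : ℝ} (ha : 0 < a) (ϑ : ℝ) : Measurable (spiralLog a ϑ) := by
  unfold spiralLog
  simp_rw [windingNumber_eq_floor ha]
  have h1 : Measurable fun z : ℂ => Real.log ‖z‖ := Real.measurable_log.comp measurable_norm
  have h2 : Measurable fun z : ℂ => z.arg := Complex.measurable_arg
  have h3 : Measurable fun z : ℂ =>
      ((⌊(z.arg - ϑ - Real.log ‖z‖ / a) / (2 * Real.pi)⌋ + 1 : ℤ) : ℝ) := by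
    have : Measurable fun z : ℂ => ⌊(z.arg - ϑ - Real.log ‖z‖ / a) / (2 * Real.pi)⌋ :=
      Int.measurable_floor.comp (by fun_prop)
    exact (measurable_from_top (f := fun n : ℤ => ((n + 1 : ℤ) : ℝ))).comp this
  have h4 : Measurable fun z : ℂ =>
      (((⌊(z.arg - ϑ - Real.log ‖z‖ / a) / (2 * Real.pi)⌋ + 1 : ℤ) : ℝ) : ℂ) :=
    Complex.measurable_ofReal.comp h3
  simp only [Complex.ofReal_intCast] at h4
  fun_prop

lemma spiralCurve_eq_exp (a ϑ s : ℝ) :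
    spiralCurve a ϑ s = Complex.exp ((a + Complex.I) * s - a * ϑ) := by
  rw [spiralCurve, Complex.ofReal_exp, ← Complex.exp_add]
  congr 1
  push_cast; ring

lemma exp_mem_range_spiralCurve {a ϑ : ℝ} {ζ : ℂ} :
    Complex.exp ζ ∈ Set.range (spiralCurve a ϑ) ↔ ∃ n : ℤ, offset a ϑ ζ = 2 * Real.pi * a * n := by
  constructor
  · rintro ⟨s, hs⟩
    rw [spiralCurve_eq_exp, Complex.exp_eq_exp_iff_exists_int] at hs
    obtain ⟨n, hn⟩ := hs
    refine ⟨n, ?_⟩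
    have hr := congrArg Complex.re hn
    have hi := congrArg Complex.im hn
    simp at hr hi
    rw [offset, ← hr, hi]
    ring
  · rintro ⟨n, hn⟩
    refine ⟨ζ.im + n * (2 * Real.pi), ?_⟩
    rw [spiralCurve_eq_exp, Complex.exp_eq_exp_iff_exists_int]
    refine ⟨n, ?_⟩
    rw [offset] at hn
    apply Complex.ext
    · simp; linarith
    · simp

/-- The preimage of the spiral under `exp` consists of the lines with offset in `2πa ℤ`, and only
one of them meets the half-open strip. -/
lemma mem_range_spiralCurve_iff {a ϑ : ℝ} (ha : 0 < a) {z : ℂ} (hz : z ≠ 0) :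
    z ∈ Set.range (spiralCurve a ϑ) ↔ offset a ϑ (spiralLog a ϑ z) = 2 * Real.pi * a := by
  have hpos : 0 < 2 * Real.pi * a := by have := Real.pi_pos; positivity
  conv_lhs => rw [← exp_spiralLog (a := a) (ϑ := ϑ) hz]
  rw [exp_mem_range_spiralCurve]
  obtain ⟨h1, h2⟩ := offset_spiralLog_mem ha ϑ z
  constructor
  · rintro ⟨n, hn⟩
    rw [hn] at h1 h2 ⊢
    have hn1 : (0 : ℝ) < n := pos_of_mul_pos_right h1 hpos.le
    have hn2 : (n : ℝ) ≤ 1 := by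
      by_contra h
      nlinarith
    have : n = 1 := by
      have h3 : 0 < n := by exact_mod_cast hn1
      have h4 : n ≤ 1 := by exact_mod_cast hn2
      omega
    simp [this]
  · intro h
    exact ⟨1, by simp [h]⟩

/-- Off the spiral the offset is strictly inside the strip, so a local continuous logarithm stays in
the strip and must coincide with `spiralLog`. -/
lemma spiralLog_eventuallyEq {a ϑ : ℝ} (ha : 0 < a) {z : ℂ} (hz : z ≠ 0)
    (hzs : z ∉ Set.range (spiralCurve a ϑ)) :
    ∀ᶠ y in 𝓝 z, y ≠ 0 ∧ spiralLog a ϑ y = spiralLog a ϑ z + Complex.log (y / z) ∧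
      y ∉ Set.range (spiralCurve a ϑ) := by
  rw [mem_range_spiralCurve_iff ha hz] at hzs
  obtain ⟨h1, h2⟩ := offset_spiralLog_mem ha ϑ z
  have h3 := lt_of_le_of_ne h2 hzs
  set f : ℂ → ℂ := fun y => spiralLog a ϑ z + Complex.log (y / z) with hf
  have hfz : f z = spiralLog a ϑ z := by simp [hf, div_self hz]
  have hfc : ContinuousAt f z := by
    refine continuousAt_const.add (ContinuousAt.clog (by fun_prop) ?_)
    simp [div_self hz]
  have hoc : ContinuousAt (fun y => offset a ϑ (f y)) z :=
    (continuous_offset a ϑ).continuousAt.comp hfc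
  filter_upwards [hoc.eventually_mem (Ioo_mem_nhds (by rwa [hfz]) (by rwa [hfz])),
    eventually_ne_nhds hz] with y hy hy0
  have hexp : Complex.exp (f y) = y := by
    rw [hf, Complex.exp_add, exp_spiralLog hz, Complex.exp_log (div_ne_zero hy0 hz)]
    field_simp
  have hL : spiralLog a ϑ y = f y := by
    conv_lhs => rw [← hexp]
    exact spiralLog_exp ha ⟨hy.1, hy.2.le⟩
  refine ⟨hy0, hL, ?_⟩
  rw [mem_range_spiralCurve_iff ha hy0, hL]
  exact hy.2.ne

lemma hasDerivAt_spiralLog {a ϑ : ℝ} (ha : 0 < a) {z : ℂ} (hz : z ≠ 0)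
    (hzs : z ∉ Set.range (spiralCurve a ϑ)) : HasDerivAt (spiralLog a ϑ) z⁻¹ z := by
  have h := ((hasDerivAt_id z).div_const z).clog (by simp [div_self hz])
  have h' := h.const_add (spiralLog a ϑ z)
  simp only [id, div_self hz, div_one, one_div] at h'
  exact h'.congr_of_eventuallyEq
    ((spiralLog_eventuallyEq ha hz hzs).mono fun y hy => hy.2.1)

lemma offset_add_mul (a ϑ t : ℝ) (ζ : ℂ) :
    offset a ϑ (ζ + (a + Complex.I) * t) = offset a ϑ ζ := by
  simp [offset]; ring

lemma spiralLog_exp_mul {a : ℝ} (ha : 0 < a) (ϑ : ℝ) {z : ℂ} (hz : z ≠ 0) (t : ℝ) :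
    spiralLog a ϑ (Complex.exp ((a + Complex.I) * t) * z) =
      spiralLog a ϑ z + (a + Complex.I) * t := by
  conv_lhs => rw [← exp_spiralLog (a := a) (ϑ := ϑ) hz]
  rw [← Complex.exp_add, add_comm]
  apply spiralLog_exp ha
  rw [offset_add_mul]
  exact offset_spiralLog_mem ha ϑ z

/-! ### The complement of a family of spirals -/

section Family

variable {M : ℕ} {a : ℝ} {ϑ : Fin M → ℝ}

lemma mem_spiralComplement {z : ℂ} : z ∈ spiralComplement a ϑ ↔
    z ≠ 0 ∧ ∀ m, z ∉ Set.range (spiralCurve a (ϑ m)) := by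
  simp only [spiralComplement, Set.mem_compl_iff, Set.mem_union, Set.mem_iUnion,
    Set.mem_singleton_iff, not_or, not_exists]
  tauto

lemma isOpen_spiralComplement (ha : 0 < a) : IsOpen (spiralComplement a ϑ) := by
  rw [isOpen_iff_mem_nhds]
  intro z hz
  obtain ⟨hz0, hzm⟩ := mem_spiralComplement.1 hz
  filter_upwards [eventually_ne_nhds hz0,
    eventually_all.2 fun m => spiralLog_eventuallyEq ha hz0 (hzm m)] with y hy0 hy
  exact mem_spiralComplement.2 ⟨hy0, fun m => (hy m).2.2⟩

lemma exp_mul_mem_spiralComplement {z : ℂ} (hz : z ∈ spiralComplement a ϑ) (t : ℝ) :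
    Complex.exp ((a + Complex.I) * t) * z ∈ spiralComplement a ϑ := by
  obtain ⟨hz0, hzm⟩ := mem_spiralComplement.1 hz
  refine mem_spiralComplement.2 ⟨mul_ne_zero (Complex.exp_ne_zero _) hz0, fun m => ?_⟩
  have h := hzm m
  rw [← Complex.exp_log hz0, exp_mem_range_spiralCurve] at h
  rwa [← Complex.exp_log hz0, ← Complex.exp_add, add_comm, exp_mem_range_spiralCurve,
    offset_add_mul]

lemma exp_mul_spiralCurve (a ϑ s t : ℝ) :
    Complex.exp ((a + Complex.I) * t) * spiralCurve a ϑ s = spiralCurve a ϑ (s + t) := by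
  rw [spiralCurve_eq_exp, spiralCurve_eq_exp, ← Complex.exp_add]
  congr 1
  push_cast; ring

/-- Makes limits taken off the spirals unique at points of the spirals. Moving `ζ` slightly to the
right increases every offset, and none reaches its next multiple of `2πa` immediately. -/
lemma exp_mem_closure_spiralComplement (ha : 0 < a) (ζ : ℂ) :
    Complex.exp ζ ∈ closure (spiralComplement a ϑ) := by
  have hpos : 0 < 2 * Real.pi * a := by have := Real.pi_pos; positivity
  have hev : ∀ m, ∀ᶠ x : ℝ in 𝓝[>] 0, Complex.exp (ζ + x) ∉ Set.range (spiralCurve a (ϑ m)) := by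
    intro m
    set q := offset a (ϑ m) ζ / (2 * Real.pi * a) with hq
    have hlt : 0 < 2 * Real.pi * a * (⌊q⌋ + 1 - q) :=
      mul_pos hpos (by linarith [Int.lt_floor_add_one q])
    filter_upwards [Ioo_mem_nhdsGT hlt] with x hx
    rw [exp_mem_range_spiralCurve]
    rintro ⟨n, hn⟩
    have ho : offset a (ϑ m) (ζ + x) = 2 * Real.pi * a * q + x := by
      rw [hq, mul_div_cancel₀ _ hpos.ne', offset, offset]; simp; ring
    rw [ho] at hn
    have h1 : q < n := by
      by_contra h
      push Not at h
      nlinarith [hx.1]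
    have h2 : (n : ℝ) < ⌊q⌋ + 1 := by
      by_contra h
      push Not at h
      nlinarith [hx.2]
    have h3 : ⌊q⌋ < n := Int.floor_lt.2 h1
    have h4 : n < ⌊q⌋ + 1 := by exact_mod_cast h2
    omega
  have hc : Tendsto (fun x : ℝ => Complex.exp (ζ + x)) (𝓝[>] 0) (𝓝 (Complex.exp ζ)) := by
    have : Continuous fun x : ℝ => Complex.exp (ζ + x) := by fun_prop
    have h := this.tendsto 0
    simp only [Complex.ofReal_zero, add_zero] at h
    exact h.mono_left nhdsWithin_le_nhds
  refine mem_closure_of_tendsto hc ?_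
  filter_upwards [eventually_all.2 hev] with x hx
  exact mem_spiralComplement.2 ⟨Complex.exp_ne_zero _, hx⟩

lemma tendsto_exp_mul_atBot (ha : 0 < a) (z : ℂ) :
    Tendsto (fun t : ℝ => Complex.exp ((a + Complex.I) * t) * z) atBot (𝓝 0) := by
  rw [tendsto_zero_iff_norm_tendsto_zero]
  have e : ∀ t : ℝ, ‖Complex.exp ((a + Complex.I) * t) * z‖ = Real.exp (a * t) * ‖z‖ := by
    intro t
    rw [norm_mul, Complex.norm_exp]
    simp
  simp_rw [e]
  have : Tendsto (fun t : ℝ => a * t) atBot atBot := tendsto_id.const_mul_atBot ha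
  simpa using (Real.tendsto_exp_atBot.comp this).mul_const ‖z‖

lemma tendsto_exp_mul_nhdsWithin (ha : 0 < a) {z : ℂ} (hz : z ∈ spiralComplement a ϑ) :
    Tendsto (fun t : ℝ => Complex.exp ((a + Complex.I) * t) * z) atBot
      (𝓝[spiralComplement a ϑ] 0) :=
  tendsto_nhdsWithin_iff.2
    ⟨tendsto_exp_mul_atBot ha z, Eventually.of_forall fun t => exp_mul_mem_spiralComplement hz t⟩

end Family

/-! ### Homogeneous functions cut along a spiral -/

/-- The exponent `i A = 2 a / (a + i)`. -/
noncomputable def spiralExponent (a : ℝ) : ℂ := Complex.I * constA a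

lemma add_I_ne_zero (a : ℝ) : (a : ℂ) + Complex.I ≠ 0 := fun h => by
  simpa using congrArg Complex.im h

lemma spiralExponent_eq (a : ℝ) : spiralExponent a = 2 * a / (a + Complex.I) := by
  rw [spiralExponent, constA, mul_div_assoc']
  congr 1
  linear_combination (-2 * (a : ℂ)) * Complex.I_sq

lemma spiralExponent_mul (a : ℝ) : spiralExponent a * (a + Complex.I) = 2 * a := by
  rw [spiralExponent_eq, div_mul_cancel₀ _ (add_I_ne_zero a)]

/-- The power `z ^ (i A)` cut along the spiral with phase `ϑ`. -/
noncomputable def spiralPow (a ϑ : ℝ) (z : ℂ) : ℂ :=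
  Complex.exp (spiralExponent a * spiralLog a ϑ z)

lemma eq_add_offset (a ϑ : ℝ) (ζ : ℂ) :
    ζ = (a + Complex.I) * ζ.im + (offset a ϑ ζ - a * ϑ : ℝ) := by
  apply Complex.ext <;> simp [offset]
  ring

/-- In `ζ = (a + i) s + (σ - a ϑ)` the first term contributes exactly `e^{2 a s}`, because `i A (a +
i) = 2 a`, and the offset `σ` ranges over a compact interval. -/
lemma exists_norm_exp_le (a ϑ : ℝ) : ∃ C : ℝ, ∀ ζ : ℂ,
    offset a ϑ ζ ∈ Set.Icc 0 (2 * Real.pi * a) →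
    ‖Complex.exp (spiralExponent a * ζ)‖ ≤ C * Real.exp (2 * ζ.re) := by
  have hc : ContinuousOn (fun x : ℝ => Real.exp (((spiralExponent a).re - 2) * (x - a * ϑ)))
      (Set.Icc 0 (2 * Real.pi * a)) := by fun_prop
  obtain ⟨C, hC⟩ := isCompact_Icc.exists_bound_of_continuousOn hc
  refine ⟨C, fun ζ hζ => ?_⟩
  have h := hC _ hζ
  rw [Real.norm_of_nonneg (Real.exp_pos _).le] at h
  have e : (spiralExponent a * ζ).re =
      ((spiralExponent a).re - 2) * (offset a ϑ ζ - a * ϑ) + 2 * ζ.re := by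
    have h1 : spiralExponent a * ζ =
        2 * a * ζ.im + spiralExponent a * (offset a ϑ ζ - a * ϑ : ℝ) := by
      conv_lhs => rw [eq_add_offset a ϑ ζ, mul_add, ← mul_assoc, spiralExponent_mul]
    rw [h1, Complex.add_re, Complex.re_mul_ofReal]
    simp [offset]
    ring
  rw [Complex.norm_exp, e, Real.exp_add]
  exact mul_le_mul_of_nonneg_right h (Real.exp_pos _).le

lemma exists_norm_spiralPow_le {a : ℝ} (ha : 0 < a) (ϑ : ℝ) :
    ∃ C : ℝ, ∀ z : ℂ, z ≠ 0 → ‖spiralPow a ϑ z‖ ≤ C * ‖z‖ ^ 2 := by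
  obtain ⟨C, hC⟩ := exists_norm_exp_le a ϑ
  refine ⟨C, fun z hz => ?_⟩
  have h := hC (spiralLog a ϑ z) (Set.Ioc_subset_Icc_self (offset_spiralLog_mem ha ϑ z))
  have e : Real.exp (2 * (spiralLog a ϑ z).re) = ‖z‖ ^ 2 := by
    conv_rhs => rw [← exp_spiralLog (a := a) (ϑ := ϑ) hz, Complex.norm_exp, ← Real.exp_nat_mul]
    simp
  rwa [e] at h

lemma measurable_spiralPow {a : ℝ} (ha : 0 < a) (ϑ : ℝ) : Measurable (spiralPow a ϑ) :=
  Complex.measurable_exp.comp ((measurable_spiralLog ha ϑ).const_mul _)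

lemma spiralPow_exp_mul {a : ℝ} (ha : 0 < a) (ϑ : ℝ) {z : ℂ} (hz : z ≠ 0) (t : ℝ) :
    spiralPow a ϑ (Complex.exp ((a + Complex.I) * t) * z) =
      Real.exp (2 * a * t) * spiralPow a ϑ z := by
  rw [spiralPow, spiralLog_exp_mul ha ϑ hz, mul_add, ← mul_assoc, spiralExponent_mul,
    Complex.exp_add, spiralPow, mul_comm]
  push_cast
  rfl

lemma hasDerivAt_spiralPow {a ϑ : ℝ} (ha : 0 < a) {z : ℂ} (hz : z ≠ 0)
    (hzs : z ∉ Set.range (spiralCurve a ϑ)) :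
    HasDerivAt (spiralPow a ϑ) (spiralExponent a * (spiralPow a ϑ z / z)) z := by
  have h := ((hasDerivAt_spiralLog ha hz hzs).const_mul (spiralExponent a)).cexp
  refine h.congr_deriv ?_
  rw [spiralPow]; ring

/-! ### The Cauchy-Riemann operator applied to the homogeneous functions -/

lemma det_restrictScalars_smulRight (c : ℂ) :
    ((ContinuousLinearMap.toSpanSingleton ℂ c).restrictScalars ℝ : ℂ →L[ℝ] ℂ).det =
      Complex.normSq c := by
  rw [← Algebra.norm_complex_apply, Algebra.norm_apply, ContinuousLinearMap.det]
  congr 1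
  ext x
  simp [mul_comm]

/-- Integration in logarithmic coordinates on the strip on which `exp` is injective. -/
lemma integral_eq_integral_strip {a : ℝ} (ha : 0 < a) (ϑ : ℝ) (F : ℂ → ℂ) :
    ∫ z, F z = ∫ ζ in {ζ | offset a ϑ ζ ∈ Set.Ioc 0 (2 * Real.pi * a)},
      (Complex.normSq (Complex.exp ζ) : ℂ) * F (Complex.exp ζ) := by
  set S : Set ℂ := {ζ | offset a ϑ ζ ∈ Set.Ioc 0 (2 * Real.pi * a)} with hS
  have hmeas : MeasurableSet S := (continuous_offset a ϑ).measurable measurableSet_Ioc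
  have himg : Complex.exp '' S = {0}ᶜ := by
    ext z
    constructor
    · rintro ⟨ζ, -, rfl⟩
      exact Complex.exp_ne_zero ζ
    · intro hz
      exact ⟨spiralLog a ϑ z, offset_spiralLog_mem ha ϑ z, exp_spiralLog hz⟩
  have hinj : Set.InjOn Complex.exp S := fun x hx y hy h => by
    rw [← spiralLog_exp ha hx, ← spiralLog_exp ha hy, h]
  have h := integral_image_eq_integral_abs_det_fderiv_smul volume hmeas
    (fun ζ _ => ((Complex.hasDerivAt_exp ζ).hasFDerivAt.restrictScalars ℝ).hasFDerivWithinAt)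
    hinj F
  rw [himg, restrict_compl_singleton] at h
  rw [h]
  congr 1 with ζ
  rw [det_restrictScalars_smulRight, abs_of_nonneg (Complex.normSq_nonneg _), Complex.real_smul]

/-- Coordinates adapted to the spiral: `s` runs along it and `σ` is the offset. -/
noncomputable def stripCoord (a ϑ : ℝ) (p : ℝ × ℝ) : ℂ :=
  (a + Complex.I) * p.1 + p.2 - a * ϑ

lemma stripCoord_re (a ϑ : ℝ) (p : ℝ × ℝ) : (stripCoord a ϑ p).re = a * p.1 + p.2 - a * ϑ := by
  simp [stripCoord]

lemma stripCoord_im (a ϑ : ℝ) (p : ℝ × ℝ) : (stripCoord a ϑ p).im = p.1 := by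
  simp [stripCoord]

lemma offset_stripCoord (a ϑ : ℝ) (p : ℝ × ℝ) : offset a ϑ (stripCoord a ϑ p) = p.2 := by
  rw [offset, stripCoord_re, stripCoord_im]; ring

lemma continuous_stripCoord (a ϑ : ℝ) : Continuous (stripCoord a ϑ) := by
  unfold stripCoord; fun_prop

lemma measurableEmbedding_stripCoord (a ϑ : ℝ) : MeasurableEmbedding (stripCoord a ϑ) := by
  refine (continuous_stripCoord a ϑ).measurableEmbedding fun p q h => ?_
  have h1 : p.1 = q.1 := by rw [← stripCoord_im a ϑ p, h, stripCoord_im]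
  have h2 : p.2 = q.2 := by rw [← offset_stripCoord a ϑ p, h, offset_stripCoord]
  exact Prod.ext h1 h2

/-- A shear followed by a swap of the axes. -/
lemma measurePreserving_stripCoord (a ϑ : ℝ) : MeasurePreserving (stripCoord a ϑ) := by
  have h1 : MeasurePreserving (fun p : ℝ × ℝ => (p.1, p.2 + (a * p.1 - a * ϑ)))
      (volume.prod volume) (volume.prod volume) := by
    refine MeasurePreserving.skew_product (f := id)
      (g := fun s σ : ℝ => σ + (a * s - a * ϑ)) (MeasurePreserving.id _) ?_ ?_
    · exact (by fun_prop : Continuous (Function.uncurry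
        fun s σ : ℝ => σ + (a * s - a * ϑ))).measurable
    · exact Eventually.of_forall fun s => (measurePreserving_add_right volume _).map_eq
  have h := Complex.volume_preserving_equiv_real_prod.symm.comp
    (Measure.measurePreserving_swap.comp h1)
  have e : stripCoord a ϑ = Complex.measurableEquivRealProd.symm ∘ Prod.swap ∘
      fun p : ℝ × ℝ => (p.1, p.2 + (a * p.1 - a * ϑ)) := by
    ext p
    apply Complex.ext
    · rw [stripCoord_re]
      simp [Complex.measurableEquivRealProd_symm_apply]
      ring
    · rw [stripCoord_im]
      simp [Complex.measurableEquivRealProd_symm_apply]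
  rw [e]
  exact h

lemma setIntegral_strip (a ϑ : ℝ) (G : ℂ → ℂ) :
    ∫ ζ in {ζ | offset a ϑ ζ ∈ Set.Ioc 0 (2 * Real.pi * a)}, G ζ =
      ∫ p, G (stripCoord a ϑ p)
        ∂(volume : Measure ℝ).prod (volume.restrict (Set.Ioc 0 (2 * Real.pi * a))) := by
  rw [← (measurePreserving_stripCoord a ϑ).setIntegral_preimage_emb
    (measurableEmbedding_stripCoord a ϑ)]
  have : stripCoord a ϑ ⁻¹' {ζ | offset a ϑ ζ ∈ Set.Ioc 0 (2 * Real.pi * a)} =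
      Set.univ ×ˢ Set.Ioc 0 (2 * Real.pi * a) := by
    ext p
    simp [offset_stripCoord]
  rw [this, Measure.volume_eq_prod, ← Measure.prod_restrict, Measure.restrict_univ]

/-- The test function `φ` in logarithmic coordinates times `exp (i A ζ)`. -/
noncomputable def liftedTest (a : ℝ) (φ : ℂ → ℝ) (ζ : ℂ) : ℂ :=
  Complex.exp (spiralExponent a * ζ) * (φ (Complex.exp ζ) : ℂ)

lemma contDiff_liftedTest (a : ℝ) {φ : ℂ → ℝ} (hφ : ContDiff ℝ ∞ φ) :
    ContDiff ℝ ∞ (liftedTest a φ) := by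
  have he : ContDiff ℝ ∞ Complex.exp := Complex.contDiff_exp
  refine (he.comp (contDiff_const.mul contDiff_id)).mul ?_
  exact Complex.ofRealCLM.contDiff.comp (hφ.comp he)

lemma fderiv_liftedTest (a : ℝ) {φ : ℂ → ℝ} (hφ : ContDiff ℝ ∞ φ) (ζ v : ℂ) :
    fderiv ℝ (liftedTest a φ) ζ v = Complex.exp (spiralExponent a * ζ) *
      (spiralExponent a * v * φ (Complex.exp ζ) +
        (fderiv ℝ φ (Complex.exp ζ) (Complex.exp ζ * v) : ℂ)) := by
  have h1 : HasFDerivAt (fun ζ : ℂ => Complex.exp (spiralExponent a * ζ)) _ ζ :=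
    (((hasDerivAt_id ζ).const_mul (spiralExponent a)).cexp).hasFDerivAt.restrictScalars ℝ
  have h2 : HasFDerivAt Complex.exp _ ζ :=
    (Complex.hasDerivAt_exp ζ).hasFDerivAt.restrictScalars ℝ
  have h3 := (hφ.differentiable (by simp) (Complex.exp ζ)).hasFDerivAt.comp ζ h2
  have h4 := Complex.ofRealCLM.hasFDerivAt.comp ζ h3
  have h : fderiv ℝ (liftedTest a φ) ζ = _ := (h1.mul h4).fderiv
  rw [h]
  simp [mul_comm v]
  ring

/-- The exponential factor is holomorphic, so the operator only sees `φ ∘ exp`, and the chain rule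
produces the conjugate of `exp ζ`. Written as `|exp ζ|² / exp ζ`, it supplies the Jacobian of `exp`
and the division by `z`. -/
lemma dbar_liftedTest (a : ℝ) {φ : ℂ → ℝ} (hφ : ContDiff ℝ ∞ φ) (ζ : ℂ) :
    dbar (liftedTest a φ) ζ = (Complex.normSq (Complex.exp ζ) : ℂ) *
      (Complex.exp (spiralExponent a * ζ) / Complex.exp ζ *
        ((fderiv ℝ φ (Complex.exp ζ) 1 : ℂ) +
          Complex.I * (fderiv ℝ φ (Complex.exp ζ) Complex.I : ℂ))) := by
  rw [dbar, fderiv_liftedTest a hφ, fderiv_liftedTest a hφ]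
  set z := Complex.exp ζ with hz
  have hz0 : z ≠ 0 := Complex.exp_ne_zero ζ
  have e : ∀ v : ℂ, fderiv ℝ φ z v = v.re * fderiv ℝ φ z 1 + v.im * fderiv ℝ φ z Complex.I := by
    intro v
    conv_lhs => rw [show v = v.re • (1 : ℂ) + v.im • Complex.I by simp [Complex.re_add_im]]
    rw [map_add, map_smul, map_smul, smul_eq_mul, smul_eq_mul]
  rw [e (z * 1), e (z * Complex.I), ← Complex.mul_conj]
  have hc : (starRingEnd ℂ) z = z.re - z.im * Complex.I := by
    conv_lhs => rw [← Complex.re_add_im z]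
    simp only [map_add, map_mul, Complex.conj_ofReal, Complex.conj_I]
    ring
  rw [hc]
  simp only [mul_one, Complex.mul_re, Complex.mul_im, Complex.I_re, Complex.I_im, mul_zero,
    zero_sub, add_zero]
  push_cast
  field_simp
  linear_combination (spiralExponent a * φ z + z.im * (fderiv ℝ φ z Complex.I : ℂ)) * Complex.I_sq

section Bounds

variable {a : ℝ} {φ : ℂ → ℝ}

/-- One dominating function for every use of Fubini and of integration along the spiral: the factor
`e^{2 a s}` gives decay as `s → -∞`, and the compact support of `φ` cuts off `s → ∞`. -/
lemma exists_liftedTest_bound (ha : 0 < a) (ϑ : ℝ) (hφ : ContDiff ℝ ∞ φ)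
    (hφc : HasCompactSupport φ) : ∃ b : ℝ → ℝ, Integrable b ∧ ∀ s σ : ℝ,
      σ ∈ Set.Icc 0 (2 * Real.pi * a) → ‖liftedTest a φ (stripCoord a ϑ (s, σ))‖ ≤ b s ∧
        ∀ v, ‖fderiv ℝ (liftedTest a φ) (stripCoord a ϑ (s, σ)) v‖ ≤ b s * ‖v‖ := by
  obtain ⟨C0, hC0⟩ := hφ.continuous.bounded_above_of_compact_support hφc
  obtain ⟨C1, hC1⟩ := (hφ.continuous_fderiv (by simp)).bounded_above_of_compact_support
    (hφc.fderiv (𝕜 := ℝ))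
  obtain ⟨C, hC⟩ := exists_norm_exp_le a ϑ
  obtain ⟨R, hRpos, hR⟩ := hφc.isCompact.isBounded.subset_closedBall_lt 0 (0 : ℂ)
  have hout : ∀ z : ℂ, R < ‖z‖ → φ z = 0 ∧ fderiv ℝ φ z = 0 := by
    intro z hz
    have hz' : z ∉ tsupport φ := fun h => by
      have := hR h
      rw [mem_closedBall_zero_iff] at this
      linarith
    refine ⟨image_eq_zero_of_notMem_tsupport hz', ?_⟩
    by_contra h
    exact hz' (support_fderiv_subset ℝ h)
  have hC0' : 0 ≤ C0 := (norm_nonneg _).trans (hC0 0)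
  have hC1' : 0 ≤ C1 := (norm_nonneg _).trans (hC1 0)
  have hCpos : 0 ≤ |C| := abs_nonneg C
  set N := ‖spiralExponent a‖ with hN
  have hN0 : 0 ≤ N := norm_nonneg _
  -- `C0` serves the function itself; `N * C0 + C1 * R` serves its derivative, using `‖exp ζ‖ ≤ R`
  -- where `fderiv ℝ φ` is not zero.
  set D := C0 + N * C0 + C1 * R with hD
  set K := |C| * Real.exp (2 * (2 * Real.pi * a - a * ϑ)) * D with hK
  -- Beyond `s1` every point of the strip is mapped outside the ball of radius `R`, since `σ ≥ 0`.
  set s1 := Real.log R / a + ϑ with hs1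
  refine ⟨(Set.Iic s1).indicator fun s => K * Real.exp (2 * a * s), ?_, ?_⟩
  · refine IntegrableOn.integrable_indicator ?_ measurableSet_Iic
    exact (integrableOn_exp_mul_Iic (by positivity) s1).const_mul K
  intro s σ hσ
  set ζ := stripCoord a ϑ (s, σ) with hζ
  have hre : ζ.re = a * s + σ - a * ϑ := stripCoord_re a ϑ (s, σ)
  have hexp := hC ζ (by rw [hζ, offset_stripCoord]; exact hσ)
  have hnorm : ‖Complex.exp ζ‖ = Real.exp ζ.re := Complex.norm_exp ζ
  by_cases hs : s ≤ s1
  · rw [Set.indicator_of_mem (Set.mem_Iic.2 hs)]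
    have hexp' : ‖Complex.exp (spiralExponent a * ζ)‖ ≤
        |C| * Real.exp (2 * (2 * Real.pi * a - a * ϑ)) * Real.exp (2 * a * s) := by
      refine hexp.trans ?_
      rw [mul_assoc, ← Real.exp_add]
      refine mul_le_mul (le_abs_self C) (Real.exp_le_exp.2 ?_) (Real.exp_pos _).le hCpos
      rw [hre]; linarith [hσ.2]
    have hmul : ∀ x : ℝ, 0 ≤ x → ∀ y : ℂ, ‖y‖ ≤ D * x →
        ‖Complex.exp (spiralExponent a * ζ) * y‖ ≤ K * Real.exp (2 * a * s) * x := by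
      intro x hx y hy
      rw [norm_mul]
      calc _ ≤ (|C| * Real.exp (2 * (2 * Real.pi * a - a * ϑ)) * Real.exp (2 * a * s)) * (D * x) :=
            mul_le_mul hexp' hy (norm_nonneg _) (by positivity)
        _ = _ := by rw [hK]; ring
    constructor
    · have := hmul 1 zero_le_one (φ (Complex.exp ζ) : ℂ) (by
        rw [Complex.norm_real, mul_one]
        have : 0 ≤ N * C0 + C1 * R := by positivity
        exact (hC0 _).trans (by rw [hD]; linarith))
      rwa [mul_one] at this
    · intro v
      rw [fderiv_liftedTest a hφ]
      refine hmul ‖v‖ (norm_nonneg v) _ ((norm_add_le _ _).trans ?_)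
      rw [norm_mul, norm_mul, Complex.norm_real, Complex.norm_real]
      have h1 : ‖spiralExponent a‖ * ‖v‖ * ‖φ (Complex.exp ζ)‖ ≤ N * C0 * ‖v‖ := by
        have := mul_le_mul_of_nonneg_left (hC0 (Complex.exp ζ)) (mul_nonneg hN0 (norm_nonneg v))
        linarith
      have h2 : ‖fderiv ℝ φ (Complex.exp ζ) (Complex.exp ζ * v)‖ ≤ C1 * R * ‖v‖ := by
        rcases le_or_gt ‖Complex.exp ζ‖ R with h | h
        · refine (ContinuousLinearMap.le_opNorm _ _).trans ?_
          rw [norm_mul, mul_assoc]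
          exact mul_le_mul (hC1 _) (mul_le_mul_of_nonneg_right h (norm_nonneg v))
            (by positivity) hC1'
        · rw [(hout _ h).2]
          simp only [zero_apply, norm_zero]
          positivity
      have h3 : 0 ≤ C0 * ‖v‖ := by positivity
      rw [hD]; linarith
  · rw [Set.indicator_of_notMem (by simpa using hs)]
    push Not at hs
    have hbig : R < ‖Complex.exp ζ‖ := by
      rw [hnorm, ← Real.log_lt_iff_lt_exp hRpos, hre]
      rw [hs1, ← lt_sub_iff_add_lt, div_lt_iff₀ ha] at hs
      linarith [hσ.1]
    obtain ⟨h1, h2⟩ := hout _ hbig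
    constructor
    · simp [liftedTest, h1]
    · intro v
      simp [fderiv_liftedTest a hφ, h1, h2]

end Bounds

/-- The two edges of the strip differ by `2πi` after a shift of `s` by `2π`; `φ ∘ exp` does not
notice this, and the power picks up the factor `e^{2πA}`. -/
lemma liftedTest_stripCoord_period (a ϑ : ℝ) (φ : ℂ → ℝ) (s : ℝ) :
    liftedTest a φ (stripCoord a ϑ (s, 2 * Real.pi * a)) =
      Complex.exp (2 * Real.pi * constA a) *
        liftedTest a φ (stripCoord a ϑ (s + 2 * Real.pi, 0)) := by
  have e : stripCoord a ϑ (s, 2 * Real.pi * a) =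
      stripCoord a ϑ (s + 2 * Real.pi, 0) - 2 * Real.pi * Complex.I := by
    simp only [stripCoord]; push_cast; ring
  have e2 : spiralExponent a * (2 * Real.pi * Complex.I) = -(2 * Real.pi * constA a) := by
    rw [spiralExponent]; linear_combination (2 * Real.pi * constA a) * Complex.I_sq
  rw [liftedTest, liftedTest, e, Complex.exp_periodic.sub_eq, mul_sub, e2, sub_neg_eq_add,
    Complex.exp_add]
  ring

/-- The distributional Cauchy-Riemann operator applied to `z ^ (i A) / z` is a density on the
spiral. -/
theorem integral_spiralPow_div_mul {a : ℝ} (ha : 0 < a) (ϑ : ℝ) {φ : ℂ → ℝ}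
    (hφ : ContDiff ℝ ∞ φ) (hφc : HasCompactSupport φ) :
    ∫ z, spiralPow a ϑ z / z *
        ((fderiv ℝ φ z 1 : ℂ) + Complex.I * (fderiv ℝ φ z Complex.I : ℂ)) =
      (1 - Complex.I * a) * (Complex.exp (2 * Real.pi * constA a) - 1) *
        ∫ s : ℝ, liftedTest a φ (stripCoord a ϑ (s, 0)) := by
  have hE := contDiff_liftedTest a hφ
  have hEd := hE.continuous_fderiv (by simp)
  have hT := continuous_stripCoord a ϑ
  obtain ⟨b, hb, hbound⟩ := exists_liftedTest_bound ha ϑ hφ hφc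
  have hpos : 0 ≤ 2 * Real.pi * a := by have := Real.pi_pos; positivity
  set ν : Measure ℝ := volume.restrict (Set.Ioc 0 (2 * Real.pi * a)) with hν
  have hint : ∀ v, Integrable
      (fun p => fderiv ℝ (liftedTest a φ) (stripCoord a ϑ p) v) (volume.prod ν) := by
    intro v
    have hbv : Integrable (fun p : ℝ × ℝ => b p.1 * ‖v‖) (volume.prod ν) :=
      (hb.mul_const ‖v‖).comp_fst ν
    refine hbv.mono' (by fun_prop : Continuous _).aestronglyMeasurable ?_
    have : ∀ᵐ p ∂(volume : Measure ℝ).prod ν, p.2 ∈ Set.Ioc 0 (2 * Real.pi * a) :=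
      Measure.quasiMeasurePreserving_snd.ae (ae_restrict_mem measurableSet_Ioc)
    filter_upwards [this] with p hp
    exact (hbound p.1 p.2 (Set.Ioc_subset_Icc_self hp)).2 v
  have hint0 : ∀ σ ∈ Set.Icc 0 (2 * Real.pi * a),
      Integrable (fun s : ℝ => liftedTest a φ (stripCoord a ϑ (s, σ))) := by
    intro σ hσ
    refine hb.mono' ?_ (Eventually.of_forall fun s => (hbound s σ hσ).1)
    have := hE.continuous
    exact (by fun_prop : Continuous _).aestronglyMeasurable
  have hder : ∀ ζ, HasFDerivAt (liftedTest a φ) (fderiv ℝ (liftedTest a φ) ζ) ζ := fun ζ =>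
    (hE.differentiable (by simp) ζ).hasFDerivAt
  have hcoord : ∀ s σ, HasDerivAt (fun s : ℝ => stripCoord a ϑ (s, σ)) (a + Complex.I) s := by
    intro s σ
    have := (((Complex.ofRealCLM.hasDerivAt (x := s)).const_mul (a + Complex.I)).add_const
      (σ : ℂ)).sub_const (a * ϑ : ℂ)
    simpa [stripCoord] using this
  have hcoord' : ∀ s σ, HasDerivAt (fun σ : ℝ => stripCoord a ϑ (s, σ)) 1 σ := by
    intro s σ
    have := ((Complex.ofRealCLM.hasDerivAt (x := σ)).const_add ((a + Complex.I) * s)).sub_const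
      (a * ϑ : ℂ)
    simpa [stripCoord] using this
  -- Along the spiral the total derivative integrates to zero by decay at both ends.
  have hs : ∫ p, fderiv ℝ (liftedTest a φ) (stripCoord a ϑ p) (a + Complex.I)
      ∂(volume : Measure ℝ).prod ν = 0 := by
    rw [integral_prod_symm _ (hint _)]
    refine setIntegral_eq_zero_of_forall_eq_zero fun σ hσ => ?_
    have hσ' := Set.Ioc_subset_Icc_self hσ
    refine integral_eq_zero_of_hasDerivAt_of_integrable
      (f := fun s => liftedTest a φ (stripCoord a ϑ (s, σ)))
      (fun s => (hder _).comp_hasDerivAt s (hcoord s σ)) ?_ (hint0 σ hσ')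
    refine (hb.mul_const ‖(a : ℂ) + Complex.I‖).mono' ?_
      (Eventually.of_forall fun s => (hbound s σ hσ').2 _)
    exact (by fun_prop : Continuous _).aestronglyMeasurable
  -- Across the strip only the edge values remain, and by periodicity both are integrals over the
  -- same edge.
  have hσ : ∫ p, fderiv ℝ (liftedTest a φ) (stripCoord a ϑ p) 1
      ∂(volume : Measure ℝ).prod ν = (Complex.exp (2 * Real.pi * constA a) - 1) *
        ∫ s : ℝ, liftedTest a φ (stripCoord a ϑ (s, 0)) := by
    rw [integral_prod _ (hint _)]
    have hin : ∀ s : ℝ, ∫ σ, fderiv ℝ (liftedTest a φ) (stripCoord a ϑ (s, σ)) 1 ∂ν =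
        liftedTest a φ (stripCoord a ϑ (s, 2 * Real.pi * a)) -
          liftedTest a φ (stripCoord a ϑ (s, 0)) := by
      intro s
      rw [hν, ← intervalIntegral.integral_of_le hpos]
      refine intervalIntegral.integral_eq_sub_of_hasDerivAt
        (f := fun σ => liftedTest a φ (stripCoord a ϑ (s, σ)))
        (fun σ _ => (hder _).comp_hasDerivAt σ (hcoord' s σ)) ?_
      exact (by fun_prop : Continuous _).intervalIntegrable _ _
    simp_rw [hin]
    rw [integral_sub (hint0 _ ⟨hpos, le_rfl⟩) (hint0 _ ⟨le_rfl, hpos⟩)]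
    simp_rw [liftedTest_stripCoord_period]
    rw [integral_const_mul, integral_add_right_eq_self
      (fun s => liftedTest a φ (stripCoord a ϑ (s, 0)))]
    ring
  have hmeas : MeasurableSet {ζ | offset a ϑ ζ ∈ Set.Ioc 0 (2 * Real.pi * a)} :=
    (continuous_offset a ϑ).measurable measurableSet_Ioc
  rw [integral_eq_integral_strip ha ϑ]
  have hcongr := setIntegral_congr_fun (μ := volume) hmeas
    (f := fun ζ => (Complex.normSq (Complex.exp ζ) : ℂ) *
      (spiralPow a ϑ (Complex.exp ζ) / Complex.exp ζ *
        ((fderiv ℝ φ (Complex.exp ζ) 1 : ℂ) +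
          Complex.I * (fderiv ℝ φ (Complex.exp ζ) Complex.I : ℂ))))
    (g := dbar (liftedTest a φ)) (fun ζ hζ => by
      simp only [dbar_liftedTest a hφ, spiralPow, spiralLog_exp ha hζ])
  rw [hcongr, setIntegral_strip]
  -- Writing `I = (a + I) - a` expresses the operator through the two coordinate directions of the
  -- strip.
  have hsplit : ∀ p, dbar (liftedTest a φ) (stripCoord a ϑ p) =
      (1 - Complex.I * a) * fderiv ℝ (liftedTest a φ) (stripCoord a ϑ p) 1 +
        Complex.I * fderiv ℝ (liftedTest a φ) (stripCoord a ϑ p) (a + Complex.I) := by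
    intro p
    have : (a : ℂ) + Complex.I = a • (1 : ℂ) + Complex.I := by simp
    rw [dbar, this, map_add, map_smul, Complex.real_smul]
    ring
  simp_rw [hsplit]
  rw [integral_add ((hint _).const_mul _) ((hint _).const_mul _), integral_const_mul,
    integral_const_mul, hs, hσ]
  ring

/-! ### Entire functions with self-similar normal component on a spiral -/

lemma spiralCurve_eq_mul (a ϑ s : ℝ) :
    spiralCurve a ϑ s = Complex.exp ((a + Complex.I) * s) * spiralCurve a ϑ 0 := by
  rw [exp_mul_spiralCurve, zero_add]

lemma tendsto_spiralCurve_atBot {a : ℝ} (ha : 0 < a) (ϑ : ℝ) :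
    Tendsto (spiralCurve a ϑ) atBot (𝓝 0) := by
  have := tendsto_exp_mul_atBot ha (spiralCurve a ϑ 0)
  simpa only [← spiralCurve_eq_mul] using this

/-- An entire function whose normal component along a spiral is a multiple of `e^{a s}` vanishes:
its leading term at the origin would rotate along the spiral. -/
theorem eq_zero_of_normal_component {a : ℝ} (ha : 0 < a) (ϑ : ℝ) {H : ℂ → ℂ}
    (hH : Differentiable ℂ H) {c : ℝ}
    (hc : ∀ s : ℝ, ((a + Complex.I) * Complex.exp (s * Complex.I) * H (spiralCurve a ϑ s)).im =
      c * Real.exp (a * s)) : H = 0 := by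
  have hA : AnalyticOnNhd ℂ H Set.univ := fun z _ => hH.analyticAt z
  have hev : ∀ᶠ z in 𝓝 (0 : ℂ), H z = 0 := by
    by_contra hne
    -- Near the origin `H z = z ^ n * q z` with `q 0 ≠ 0`.
    obtain ⟨n, q, hq, hq0, hHq⟩ :=
      ((hH.analyticAt 0).exists_eventuallyEq_pow_smul_nonzero_iff).2 hne
    simp only [sub_zero, smul_eq_mul] at hHq
    -- The normal component with the modulus of `z ^ n` divided out: `n` rotations come from `z ^ n`
    -- and one from the tangent.
    set u : ℝ → ℝ := fun s => ((a + Complex.I) * Complex.exp ((n + 1) * s * Complex.I) *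
      q (spiralCurve a ϑ s)).im with hu
    have hus : ∀ᶠ s in atBot, u s = c * Real.exp (a * n * ϑ) * Real.exp (a * (1 - n) * s) := by
      filter_upwards [(tendsto_spiralCurve_atBot ha ϑ).eventually hHq] with s hs
      have h := hc s
      rw [hs] at h
      have e : (a + Complex.I) * Complex.exp (s * Complex.I) *
          (spiralCurve a ϑ s ^ n * q (spiralCurve a ϑ s)) =
          (Real.exp (a * n * (s - ϑ)) : ℂ) * ((a + Complex.I) *
            Complex.exp ((n + 1) * s * Complex.I) * q (spiralCurve a ϑ s)) := by
        have e1 : spiralCurve a ϑ s ^ n =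
            (Real.exp (a * n * (s - ϑ)) : ℂ) * Complex.exp (n * s * Complex.I) := by
          rw [spiralCurve, mul_pow, ← Complex.exp_nat_mul, ← Complex.ofReal_pow, ← Real.exp_nat_mul,
            show (n : ℝ) * (a * (s - ϑ)) = a * n * (s - ϑ) by ring, mul_assoc (n : ℂ)]
        have e2 : Complex.exp ((n + 1) * s * Complex.I) =
            Complex.exp (n * s * Complex.I) * Complex.exp (s * Complex.I) := by
          rw [← Complex.exp_add]; congr 1; ring
        rw [e1, e2]; ring
      rw [e, Complex.im_ofReal_mul] at h
      have hp := Real.exp_pos (a * n * (s - ϑ))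
      have e3 : Real.exp (a * s) = Real.exp (a * n * (s - ϑ)) *
          (Real.exp (a * n * ϑ) * Real.exp (a * (1 - n) * s)) := by
        rw [← Real.exp_add, ← Real.exp_add]
        congr 1
        ring
      rw [← mul_right_inj' hp.ne']
      simp only [hu]
      rw [h, e3]
      ring
    set U : ℝ → ℝ := fun s =>
      ((a + Complex.I) * Complex.exp ((n + 1) * s * Complex.I) * q 0).im with hU
    have hseq : ∀ s0 : ℝ, Tendsto (fun k : ℕ => s0 - k * (2 * Real.pi)) atTop atBot := by
      intro s0
      have h1 : Tendsto (fun k : ℕ => (k : ℝ) * (2 * Real.pi)) atTop atTop :=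
        tendsto_natCast_atTop_atTop.atTop_mul_const (by have := Real.pi_pos; positivity)
      simpa [sub_eq_add_neg] using
        tendsto_atBot_add_const_left _ s0 (tendsto_neg_atTop_atBot.comp h1)
    -- Going back by full turns leaves the phase unchanged while the point tends to `0`, so `q` may
    -- be replaced by `q 0`.
    have hlim : ∀ s0 : ℝ, Tendsto (fun k : ℕ => u (s0 - k * (2 * Real.pi))) atTop (𝓝 (U s0)) := by
      intro s0
      have h1 : Tendsto (fun k : ℕ => q (spiralCurve a ϑ (s0 - k * (2 * Real.pi)))) atTop
          (𝓝 (q 0)) :=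
        hq.continuousAt.tendsto.comp ((tendsto_spiralCurve_atBot ha ϑ).comp (hseq s0))
      have h2 := (Complex.continuous_im.tendsto _).comp
        (h1.const_mul ((a + Complex.I) * Complex.exp ((n + 1) * s0 * Complex.I)))
      refine h2.congr fun k => ?_
      have e : ((n : ℂ) + 1) * ((s0 - k * (2 * Real.pi) : ℝ) : ℂ) * Complex.I =
          (n + 1) * s0 * Complex.I - ((n + 1) * k : ℕ) * (2 * Real.pi * Complex.I) := by
        push_cast; ring
      simp only [hu, Function.comp, e, Complex.exp_periodic.sub_nat_mul_eq]
    have hn : ((n : ℝ) + 1) ≠ 0 := by positivity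
    -- Half a period of `e^{i (n + 1) s}`: shifting by `δ` changes the sign of `U`, yet by the
    -- exponential law it multiplies `U` by a positive number.
    set δ : ℝ := Real.pi / (n + 1) with hδ
    have hanti : ∀ s0, U (s0 + δ) = -U s0 := by
      intro s0
      have e : ((n : ℂ) + 1) * ((s0 + δ : ℝ) : ℂ) * Complex.I =
          (n + 1) * s0 * Complex.I + Real.pi * Complex.I := by
        have : ((n : ℂ) + 1) * (δ : ℂ) = Real.pi := by
          have h : ((n : ℝ) + 1) * δ = Real.pi := by rw [hδ]; field_simp
          exact_mod_cast congrArg (fun x : ℝ => (x : ℂ)) h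
        push_cast
        linear_combination Complex.I * this
      simp only [hU, e, Complex.exp_add, Complex.exp_pi_mul_I]
      rw [← Complex.neg_im]
      congr 1
      ring
    have hscale : ∀ s0, U (s0 + δ) = Real.exp (a * (1 - n) * δ) * U s0 := by
      intro s0
      refine tendsto_nhds_unique (hlim (s0 + δ)) ?_
      refine ((hlim s0).const_mul _).congr' ?_
      filter_upwards [(hseq s0).eventually hus, (hseq (s0 + δ)).eventually hus] with k h1 h2
      rw [h1, h2, mul_left_comm, ← Real.exp_add]
      congr 2
      ring
    have hzero : ∀ s0, U s0 = 0 := by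
      intro s0
      have h := (hscale s0).symm.trans (hanti s0)
      have hp := Real.exp_pos (a * (1 - n) * δ)
      have : (Real.exp (a * (1 - n) * δ) + 1) * U s0 = 0 := by linarith
      exact (mul_eq_zero.1 this).resolve_left (by positivity)
    have him : ((a + Complex.I) * q 0).im = 0 := by
      simpa [hU] using hzero 0
    -- A quarter period multiplies by `i` and exchanges imaginary and real parts.
    have hre : ((a + Complex.I) * q 0).re = 0 := by
      have h := hzero (δ / 2)
      have e : ((n : ℂ) + 1) * ((δ / 2 : ℝ) : ℂ) * Complex.I = Real.pi / 2 * Complex.I := by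
        have : ((n : ℂ) + 1) * (δ : ℂ) = Real.pi := by
          have h : ((n : ℝ) + 1) * δ = Real.pi := by rw [hδ]; field_simp
          exact_mod_cast congrArg (fun x : ℝ => (x : ℂ)) h
        push_cast
        linear_combination Complex.I / 2 * this
      simp only [hU, e, Complex.exp_pi_div_two_mul_I] at h
      rw [mul_right_comm, Complex.mul_I_im] at h
      exact h
    exact mul_ne_zero (add_I_ne_zero a) hq0 (Complex.ext hre him)
  funext z
  exact congrFun (hA.eq_of_eventuallyEq (fun z _ => analyticAt_const) hev) z

/-! ### The explicit potential and velocity -/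

lemma constA_mul (a : ℝ) : constA a * (a + Complex.I) = -2 * a * Complex.I := by
  rw [constA, div_mul_cancel₀ _ (add_I_ne_zero a)]

/-- Modulus one would make `A` purely imaginary, which contradicts `A (a + i) = -2 a i`. -/
lemma exp_two_pi_constA_ne_one {a : ℝ} (ha : 0 < a) :
    Complex.exp (2 * Real.pi * constA a) ≠ 1 := by
  intro h
  have hn := congrArg norm h
  rw [Complex.norm_exp, norm_one, Real.exp_eq_one_iff] at hn
  have hre : (constA a).re = 0 := by
    have : (2 * Real.pi * constA a).re = 2 * Real.pi * (constA a).re := by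
      rw [← Complex.re_ofReal_mul]; push_cast; rfl
    rw [this] at hn
    exact (mul_eq_zero.1 hn).resolve_left (by positivity)
  have h1 := congrArg Complex.re (constA_mul a)
  have h2 := congrArg Complex.im (constA_mul a)
  simp [hre] at h1 h2
  rw [h1] at h2
  simp at h2
  exact ha.ne' h2

section Family

variable {M : ℕ}

/-- The coefficient of `spiralPow` in the potential of a single spiral. -/
noncomputable def potentialCoeff (a g ϑ : ℝ) : ℂ :=
  g * Complex.exp (ϑ * constA a) / (1 - Complex.exp (2 * Real.pi * constA a))

/-- The complex potential of the family of spirals. -/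
noncomputable def spiralPotential (a : ℝ) (g ϑ : Fin M → ℝ) (z : ℂ) : ℂ :=
  ∑ l, potentialCoeff a (g l) (ϑ l) * spiralPow a (ϑ l) z

/-- The conjugate velocity of the family of spirals. -/
noncomputable def conjVelocity (a : ℝ) (g ϑ : Fin M → ℝ) (z : ℂ) : ℂ :=
  ∑ l, potentialCoeff a (g l) (ϑ l) * spiralExponent a * (spiralPow a (ϑ l) z / z)

variable {a : ℝ} {g ϑ : Fin M → ℝ}

lemma spiralPotential_polar (ha : 0 < a) {r : ℝ} (hr : 0 < r) (θ : ℝ) :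
    spiralPotential a g ϑ (r * Complex.exp (θ * Complex.I)) = potentialFormula a g ϑ r θ := by
  refine Finset.sum_congr rfl fun l _ => ?_
  rw [spiralPow, spiralLog_polar ha _ hr, potentialCoeff, spiralExponent]

lemma conjVelocity_polar (ha : 0 < a) {r : ℝ} (hr : 0 < r) (θ : ℝ) :
    (starRingEnd ℂ) (conjVelocity a g ϑ (r * Complex.exp (θ * Complex.I))) =
      velocityFormula a g ϑ r θ := by
  have hr' : (r : ℂ) ≠ 0 := by exact_mod_cast hr.ne'
  have haI := add_I_ne_zero a
  rw [velocityFormula, conjVelocity, map_sum, Finset.mul_sum]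
  refine Finset.sum_congr rfl fun l _ => ?_
  have h1 : Complex.exp (θ * Complex.I) =
      (starRingEnd ℂ) (Complex.exp (-(θ * Complex.I))) := by
    rw [← Complex.exp_conj]; simp
  have h2 : 2 * (a : ℂ) * (g l : ℂ) / ((r : ℂ) * (a - Complex.I)) =
      (starRingEnd ℂ) (2 * (a : ℂ) * (g l : ℂ) / ((r : ℂ) * (a + Complex.I))) := by
    simp [sub_eq_add_neg, map_ofNat]
  rw [h2, ← map_mul]
  conv_rhs => rw [h1]
  rw [← map_mul]
  congr 1
  rw [Complex.cpow_def_of_ne_zero hr', ← Complex.ofReal_log hr.le, spiralPow,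
    spiralLog_polar ha _ hr, potentialCoeff, ← spiralExponent_eq]
  have e : spiralExponent a * (Real.log r +
      Complex.I * (θ - 2 * Real.pi * windingNumber a (ϑ l) r θ)) =
      Real.log r * spiralExponent a - constA a * θ +
        2 * Real.pi * windingNumber a (ϑ l) r θ * constA a := by
    simp only [spiralExponent]
    linear_combination (constA a * (θ - 2 * Real.pi * windingNumber a (ϑ l) r θ)) * Complex.I_sq
  have e' : constA a * (ϑ l - θ) = ϑ l * constA a - constA a * θ := by ring
  rw [e, e', Complex.exp_add, Complex.exp_sub, Complex.exp_sub, Complex.exp_neg]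
  have hB : spiralExponent a = 2 * a / (a + Complex.I) := spiralExponent_eq a
  generalize Complex.exp (Real.log r * spiralExponent a) = X
  rw [hB]
  have hne : 1 - Complex.exp (2 * Real.pi * constA a) ≠ 0 :=
    sub_ne_zero.2 (exp_two_pi_constA_ne_one ha).symm
  have hθ := Complex.exp_ne_zero (θ * Complex.I)
  have hθ' := Complex.exp_ne_zero (constA a * θ)
  field_simp

lemma hasDerivAt_spiralPotential (ha : 0 < a) {z : ℂ} (hz : z ∈ spiralComplement a ϑ) :
    HasDerivAt (spiralPotential a g ϑ) (conjVelocity a g ϑ z) z := by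
  obtain ⟨hz0, hzm⟩ := mem_spiralComplement.1 hz
  have := HasDerivAt.fun_sum (u := Finset.univ) fun l _ =>
    (hasDerivAt_spiralPow ha hz0 (hzm l)).const_mul (potentialCoeff a (g l) (ϑ l))
  refine this.congr_deriv (Finset.sum_congr rfl fun l _ => ?_)
  ring

lemma continuousAt_conjVelocity (ha : 0 < a) {z : ℂ} (hz : z ∈ spiralComplement a ϑ) :
    ContinuousAt (conjVelocity a g ϑ) z := by
  obtain ⟨hz0, hzm⟩ := mem_spiralComplement.1 hz
  unfold conjVelocity
  refine tendsto_finsetSum _ fun l _ => ?_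
  exact continuousAt_const.mul
    ((hasDerivAt_spiralPow ha hz0 (hzm l)).continuousAt.div continuousAt_id hz0)

lemma tendsto_spiralPotential (ha : 0 < a) :
    Tendsto (spiralPotential a g ϑ) (𝓝[spiralComplement a ϑ] 0) (𝓝 0) := by
  have h : ∀ l, Tendsto (spiralPow a (ϑ l)) (𝓝[spiralComplement a ϑ] 0) (𝓝 0) := by
    intro l
    obtain ⟨C, hC⟩ := exists_norm_spiralPow_le ha (ϑ l)
    refine squeeze_zero_norm' (a := fun z => C * ‖z‖ ^ 2) ?_ ?_
    · filter_upwards [self_mem_nhdsWithin] with z hz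
      exact hC z (mem_spiralComplement.1 hz).1
    · have : Continuous fun z : ℂ => C * ‖z‖ ^ 2 := by fun_prop
      simpa using (this.tendsto 0).mono_left nhdsWithin_le_nhds
  have := tendsto_finsetSum Finset.univ fun l _ =>
    (h l).const_mul (potentialCoeff a (g l) (ϑ l))
  unfold spiralPotential
  simpa using this

/-- The factor `e^{2 a t}` of the power is divided by `e^{(a + i) t}`. The remaining rotation `e^{-i
t}` is the inverse of the rotation of the tangent, so normal components only scale. -/
lemma conjVelocity_exp_mul (ha : 0 < a) {z : ℂ} (hz : z ≠ 0) (t : ℝ) :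
    conjVelocity a g ϑ (Complex.exp ((a + Complex.I) * t) * z) =
      Real.exp (a * t) * Complex.exp (-(t * Complex.I)) * conjVelocity a g ϑ z := by
  rw [conjVelocity, conjVelocity, Finset.mul_sum]
  refine Finset.sum_congr rfl fun l _ => ?_
  rw [spiralPow_exp_mul ha _ hz]
  have e : (Real.exp (2 * a * t) : ℂ) = Real.exp (a * t) * Complex.exp (-(t * Complex.I)) *
      Complex.exp ((a + Complex.I) * t) := by
    rw [Complex.ofReal_exp, Complex.ofReal_exp, ← Complex.exp_add, ← Complex.exp_add]
    congr 1
    push_cast; ring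
  have hne := Complex.exp_ne_zero ((a + Complex.I) * t)
  rw [e]
  field_simp

lemma locallyIntegrable_spiralPow_div (ha : 0 < a) (ϑ : ℝ) :
    LocallyIntegrable (fun z => spiralPow a ϑ z / z) := by
  obtain ⟨C, hC⟩ := exists_norm_spiralPow_le ha ϑ
  have hg : LocallyIntegrable (fun z : ℂ => C * ‖z‖) :=
    (by fun_prop : Continuous fun z : ℂ => C * ‖z‖).locallyIntegrable
  refine hg.mono ((measurable_spiralPow ha ϑ).div measurable_id).aestronglyMeasurable
    (Eventually.of_forall fun z => ?_)
  rcases eq_or_ne z 0 with rfl | hz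
  · simp
  · have hz' := norm_pos_iff.2 hz
    rw [norm_div, div_le_iff₀ hz']
    refine (hC z hz).trans (le_of_eq_of_le ?_
      (mul_le_mul_of_nonneg_right (le_abs_self (C * ‖z‖)) hz'.le))
    ring

lemma locallyIntegrable_conjVelocity (ha : 0 < a) :
    LocallyIntegrable (conjVelocity a g ϑ) := by
  unfold conjVelocity
  refine locallyIntegrable_finsetSum _ fun l _ => ?_
  exact (locallyIntegrable_spiralPow_div ha (ϑ l)).smul
    (potentialCoeff a (g l) (ϑ l) * spiralExponent a)

/-! ### Comparison of a spiral vortex sheet flow with the explicit velocity -/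

lemma hasDerivAt_spiralCurve (a ϑ s : ℝ) :
    HasDerivAt (spiralCurve a ϑ) ((a + Complex.I) * spiralCurve a ϑ s) s := by
  have h : HasDerivAt (fun s : ℝ => Complex.exp ((a + Complex.I) * s - a * ϑ)) _ s :=
    (((Complex.ofRealCLM.hasDerivAt (x := s)).const_mul ((a : ℂ) + Complex.I)).sub_const
      (a * ϑ : ℂ)).cexp
  have e : spiralCurve a ϑ = fun s : ℝ => Complex.exp ((a + Complex.I) * s - a * ϑ) :=
    funext (spiralCurve_eq_exp a ϑ)
  rw [e]
  refine h.congr_deriv ?_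
  simp [mul_comm]

lemma norm_spiralCurve (a ϑ s : ℝ) : ‖spiralCurve a ϑ s‖ = Real.exp (a * (s - ϑ)) := by
  rw [spiralCurve, norm_mul, Complex.norm_exp_ofReal_mul_I, Complex.norm_real,
    Real.norm_of_nonneg (Real.exp_pos _).le, mul_one]

lemma spiralCurve_ne_zero (a ϑ s : ℝ) : spiralCurve a ϑ s ≠ 0 := by
  rw [← norm_pos_iff, norm_spiralCurve]; exact Real.exp_pos _

lemma sheetDensity_mul_norm (a g ϑ s : ℝ) :
    sheetDensity a g ϑ s * ‖deriv (spiralCurve a ϑ) s‖ =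
      2 * a * g * Real.exp (2 * a * (s - ϑ)) := by
  have hne : ‖deriv (spiralCurve a ϑ) s‖ ≠ 0 := by
    rw [(hasDerivAt_spiralCurve a ϑ s).deriv, norm_ne_zero_iff]
    exact mul_ne_zero (add_I_ne_zero a) (spiralCurve_ne_zero a ϑ s)
  rw [sheetDensity, div_mul_cancel₀ _ hne]
  have h : HasDerivAt (circulation a g ϑ) _ s :=
    ((((hasDerivAt_id s).sub_const ϑ).const_mul (2 * a)).exp).const_mul g
  rw [h.deriv]
  simp only [id]
  ring

/-- Since `n = -i τ`, one has `n · u = Im (τ u*)`, which is real linear in the conjugate velocity.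
-/
lemma inner_unitNormal (a ϑ s : ℝ) (u : ℂ) : inner ℝ (unitNormal a ϑ s) u =
    ((a + Complex.I) * Complex.exp (s * Complex.I) * (starRingEnd ℂ) u).im /
      ‖(a : ℂ) + Complex.I‖ := by
  have hpos := Real.exp_pos (a * (s - ϑ))
  have ht : unitTangent a ϑ s =
      (a + Complex.I) * Complex.exp (s * Complex.I) / (‖(a : ℂ) + Complex.I‖ : ℂ) := by
    rw [unitTangent, (hasDerivAt_spiralCurve a ϑ s).deriv, norm_mul, norm_spiralCurve, spiralCurve]
    have h1 : (Real.exp (a * (s - ϑ)) : ℂ) ≠ 0 := by exact_mod_cast hpos.ne'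
    have h2 : (‖(a : ℂ) + Complex.I‖ : ℂ) ≠ 0 := by
      exact_mod_cast norm_ne_zero_iff.2 (add_I_ne_zero a)
    push_cast at h1 ⊢
    field_simp
  rw [Complex.inner, unitNormal, ht, ← Complex.div_ofReal_im, ← Complex.conj_re]
  simp only [map_mul, map_neg, Complex.conj_conj, Complex.conj_I]
  set x := (a + Complex.I) * Complex.exp (s * Complex.I) / (‖(a : ℂ) + Complex.I‖ : ℂ) with hx
  rw [show (a + Complex.I) * Complex.exp (s * Complex.I) * (starRingEnd ℂ) u /
    (‖(a : ℂ) + Complex.I‖ : ℂ) = x * (starRingEnd ℂ) u by rw [hx]; ring]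
  simp
  ring

/-- The coefficients are normalized for this: `i A (1 - i a) = -2 a i`, the jump `e^{2πA} - 1`
cancels the denominator up to sign, and `e^{ϑ A}` turns the edge value of the power into `e^{2 a (s
- ϑ)}`. -/
lemma integral_conjVelocity_mul (ha : 0 < a) {φ : ℂ → ℝ}
    (hφ : ContDiff ℝ ∞ φ) (hφc : HasCompactSupport φ) :
    ∫ z, conjVelocity a g ϑ z *
        ((fderiv ℝ φ z 1 : ℂ) + Complex.I * (fderiv ℝ φ z Complex.I : ℂ)) =
      Complex.I * ((∑ m, ∫ s : ℝ, φ (spiralCurve a (ϑ m) s) * sheetDensity a (g m) (ϑ m) s *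
        ‖deriv (spiralCurve a (ϑ m)) s‖ : ℝ) : ℂ) := by
  simp_rw [conjVelocity, Finset.sum_mul, mul_assoc (potentialCoeff a _ _ * spiralExponent a)]
  rw [integral_finsetSum _ fun l _ => (integrable_mul_fderiv
    (locallyIntegrable_spiralPow_div ha (ϑ l)) hφ hφc).const_mul _]
  rw [Complex.ofReal_sum, Finset.mul_sum]
  refine Finset.sum_congr rfl fun l _ => ?_
  rw [integral_const_mul, integral_spiralPow_div_mul ha _ hφ hφc, ← integral_complex_ofReal,
    ← integral_const_mul, ← integral_const_mul, ← integral_const_mul]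
  congr 1 with s
  rw [mul_assoc (φ _), sheetDensity_mul_norm, liftedTest]
  have hc : stripCoord a (ϑ l) (s, 0) = (a + Complex.I) * s - a * ϑ l := by
    simp [stripCoord]
  rw [hc, ← spiralCurve_eq_exp]
  have hne : 1 - Complex.exp (2 * Real.pi * constA a) ≠ 0 :=
    sub_ne_zero.2 (exp_two_pi_constA_ne_one ha).symm
  have h1 : Complex.exp (ϑ l * constA a) *
      Complex.exp (spiralExponent a * ((a + Complex.I) * s - a * ϑ l)) =
      Real.exp (2 * a * (s - ϑ l)) := by
    rw [← Complex.exp_add, Complex.ofReal_exp]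
    congr 1
    push_cast
    have h2 : constA a = -Complex.I * spiralExponent a := by
      rw [spiralExponent]; linear_combination constA a * Complex.I_sq
    rw [h2]
    linear_combination (s - ϑ l : ℂ) * spiralExponent_mul a
  have h3 : spiralExponent a * (1 - Complex.I * a) = -Complex.I * (2 * a) := by
    linear_combination (-Complex.I) * spiralExponent_mul a + spiralExponent a * Complex.I_sq
  push_cast at h1 ⊢
  have h4 : (1 - Complex.exp (2 * Real.pi * constA a))⁻¹ *
      (Complex.exp (2 * Real.pi * constA a) - 1) = -1 := by
    linear_combination -inv_mul_cancel₀ hne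
  rw [potentialCoeff, ← h1, div_eq_mul_inv]
  set P := Complex.exp (ϑ l * constA a)
  set Q := Complex.exp (spiralExponent a * ((a + Complex.I) * s - a * ϑ l))
  set f : ℂ := (φ (spiralCurve a (ϑ l) s) : ℂ)
  linear_combination ((g l : ℂ) * P * spiralExponent a * (1 - Complex.I * a) * Q * f) * h4 -
    ((g l : ℂ) * P * Q * f) * h3

lemma locallyIntegrable_conj {w : ℂ → ℂ} (hw : LocallyIntegrable w) :
    LocallyIntegrable (fun z => (starRingEnd ℂ) (w z)) := by
  intro x
  obtain ⟨s, hs, hi⟩ := hw x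
  exact ⟨s, hs, Complex.conjCLE.toContinuousLinearMap.integrable_comp hi⟩

/-- The real part of the integrand is the weak divergence of `w`, the imaginary part its weak curl.
-/
lemma integral_conj_mul_of_weak {w : ℂ → ℂ} (hw : LocallyIntegrable w)
    (hw_div : WeaklyDivFree w) (hw_curl : WeakCurlEqSpiralSheets a g ϑ w) {φ : ℂ → ℝ}
    (hφ : ContDiff ℝ ∞ φ) (hφc : HasCompactSupport φ) :
    ∫ z, (starRingEnd ℂ) (w z) *
        ((fderiv ℝ φ z 1 : ℂ) + Complex.I * (fderiv ℝ φ z Complex.I : ℂ)) =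
      Complex.I * ((∑ m, ∫ s : ℝ, φ (spiralCurve a (ϑ m) s) * sheetDensity a (g m) (ϑ m) s *
        ‖deriv (spiralCurve a (ϑ m)) s‖ : ℝ) : ℂ) := by
  have hi := integrable_mul_fderiv (locallyIntegrable_conj hw) hφ hφc
  rw [← hw_curl φ hφ hφc, ← integral_neg]
  have hd := hw_div φ hφ hφc
  apply Complex.ext
  · have h := integral_re hi
    simp only [RCLike.re_eq_complex_re] at h
    rw [← h]
    simp only [Complex.I_mul_re, Complex.ofReal_im, neg_zero]
    rw [← hd]
    congr 1 with z
    simp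
  · have h := integral_im hi
    simp only [RCLike.im_eq_complex_im] at h
    rw [← h]
    simp only [Complex.I_mul_im, Complex.ofReal_re]
    congr 1 with z
    simp
    ring

lemma weaklyHolomorphic_sub {w : ℂ → ℂ} (ha : 0 < a) (hw : LocallyIntegrable w)
    (hw_div : WeaklyDivFree w) (hw_curl : WeakCurlEqSpiralSheets a g ϑ w) :
    WeaklyHolomorphic (fun z => (starRingEnd ℂ) (w z) - conjVelocity a g ϑ z) := by
  intro φ hφ hφc
  simp_rw [sub_mul]
  rw [integral_sub (integrable_mul_fderiv (locallyIntegrable_conj hw) hφ hφc)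
    (integrable_mul_fderiv (locallyIntegrable_conjVelocity ha) hφ hφc),
    integral_conj_mul_of_weak hw hw_div hw_curl hφ hφc, integral_conjVelocity_mul ha hφ hφc,
    sub_self]

lemma tendsto_exp_mul_nhdsWithin_spiralCurve (ϑ₀ s : ℝ) :
    Tendsto (fun z => Complex.exp ((a + Complex.I) * s) * z)
      (𝓝[spiralComplement a ϑ] (spiralCurve a ϑ₀ 0))
      (𝓝[spiralComplement a ϑ] (spiralCurve a ϑ₀ s)) := by
  refine tendsto_nhdsWithin_iff.2 ⟨?_, ?_⟩
  · rw [spiralCurve_eq_mul a ϑ₀ s]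
    exact ((continuous_const_mul _).tendsto _).mono_left nhdsWithin_le_nhds
  · filter_upwards [self_mem_nhdsWithin] with z hz using exp_mul_mem_spiralComplement hz s

/-- The velocity field is determined off the spirals. -/
theorem conj_eq_conjVelocity {μ : ℝ} (ha : 0 < a) (m : Fin M) {w : ℂ → ℂ}
    (hw_loc : LocallyIntegrable w) (hw_cont : ContinuousOn w (spiralComplement a ϑ))
    (hw_div : WeaklyDivFree w) (hw_curl : WeakCurlEqSpiralSheets a g ϑ w)
    (hw_match : VelocityMatching a μ ϑ w) :
    ∀ z ∈ spiralComplement a ϑ, (starRingEnd ℂ) (w z) = conjVelocity a g ϑ z := by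
  obtain ⟨H, hH, hHw⟩ := (weaklyHolomorphic_sub ha hw_loc hw_div hw_curl).exists_entire
    ((locallyIntegrable_conj hw_loc).sub (locallyIntegrable_conjVelocity ha))
  have hR : IsOpen (spiralComplement a ϑ) := isOpen_spiralComplement ha
  have hwH : ∀ z ∈ spiralComplement a ϑ,
      (starRingEnd ℂ) (w z) - conjVelocity a g ϑ z = H z := fun z hz =>
    hHw z ((Complex.continuous_conj.continuousAt.comp
      (hw_cont.continuousAt (hR.mem_nhds hz))).sub (continuousAt_conjVelocity ha hz))
  set N : ℝ → ℂ → ℝ := fun s u => ((a + Complex.I) * Complex.exp (s * Complex.I) * u).im with hN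
  have hNc : ∀ s, Continuous (N s) := fun s => by simp only [hN]; fun_prop
  have hnorm : ‖(a : ℂ) + Complex.I‖ ≠ 0 := norm_ne_zero_iff.2 (add_I_ne_zero a)
  set Z := spiralCurve a (ϑ m) with hZ
  have hmatch : ∀ s, Tendsto (fun z => N s ((starRingEnd ℂ) (w z)))
      (𝓝[spiralComplement a ϑ] Z s) (𝓝 (μ * Real.exp (a * (s - ϑ m)))) := by
    intro s
    have h := (hw_match m s).mul_const ‖(a : ℂ) + Complex.I‖
    simp only [inner_unitNormal, div_mul_cancel₀ _ hnorm] at h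
    convert h using 2
    have e : (a + Complex.I) * Complex.exp (s * Complex.I) *
        (starRingEnd ℂ) (μ * spiralCurve a (ϑ m) s) =
        ((μ * Real.exp (a * (s - ϑ m)) : ℝ) : ℂ) * (a + Complex.I) := by
      rw [spiralCurve, map_mul, map_mul, ← Complex.exp_conj, Complex.conj_ofReal,
        Complex.conj_ofReal, map_mul, Complex.conj_I, Complex.conj_ofReal]
      have h1 : Complex.exp (s * Complex.I) * Complex.exp (s * -Complex.I) = 1 := by
        rw [← Complex.exp_add]; simp
      push_cast
      linear_combination (a + Complex.I) * μ * Complex.exp (a * (s - ϑ m)) * h1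
    rw [e, Complex.im_ofReal_mul]
    simp
  -- The normal trace of the explicit velocity. Its existence is inferred from the matching
  -- condition and the continuity of `H`, so no one-sided limits are computed.
  set β : ℝ → ℝ := fun s => μ * Real.exp (a * (s - ϑ m)) - N s (H (Z s)) with hβ
  have hlim : ∀ s, Tendsto (fun z => N s (conjVelocity a g ϑ z))
      (𝓝[spiralComplement a ϑ] Z s) (𝓝 (β s)) := by
    intro s
    have h1 : Tendsto (fun z => N s (H z)) (𝓝[spiralComplement a ϑ] Z s) (𝓝 (N s (H (Z s)))) :=
      (((hNc s).comp hH.continuous).tendsto _).mono_left nhdsWithin_le_nhds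
    refine ((hmatch s).sub h1).congr' ?_
    filter_upwards [self_mem_nhdsWithin] with z hz
    simp only [hN]
    rw [← hwH z hz, ← Complex.sub_im]
    congr 1
    ring
  -- The sliding group carries approach to `Z 0` into approach to `Z s`, so homogeneity passes to
  -- the trace.
  have hβs : ∀ s, β s = Real.exp (a * s) * β 0 := by
    intro s
    have hne : (𝓝[spiralComplement a ϑ] Z 0).NeBot := by
      rw [← mem_closure_iff_nhdsWithin_neBot, hZ, spiralCurve_eq_exp]
      exact exp_mem_closure_spiralComplement ha _
    have h1 := (hlim s).comp (tendsto_exp_mul_nhdsWithin_spiralCurve (ϑ := ϑ) (ϑ m) s)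
    refine tendsto_nhds_unique h1 (((hlim 0).const_mul (Real.exp (a * s))).congr' ?_)
    filter_upwards [self_mem_nhdsWithin] with z hz
    simp only [hN, Function.comp, conjVelocity_exp_mul ha (mem_spiralComplement.1 hz).1]
    rw [← Complex.im_ofReal_mul]
    congr 1
    have h2 : Complex.exp (s * Complex.I) * Complex.exp (-(s * Complex.I)) = 1 := by
      rw [← Complex.exp_add]; simp
    simp only [Complex.ofReal_zero, zero_mul, Complex.exp_zero, mul_one]
    linear_combination (-(Real.exp (a * s) : ℂ) * (a + Complex.I) * conjVelocity a g ϑ z) * h2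
  have hH0 : H = 0 := by
    refine eq_zero_of_normal_component ha (ϑ m) hH (c := μ * Real.exp (-(a * ϑ m)) - β 0)
      fun s => ?_
    have h := hβs s
    have e : Real.exp (a * (s - ϑ m)) = Real.exp (-(a * ϑ m)) * Real.exp (a * s) := by
      rw [← Real.exp_add]; congr 1; ring
    simp only [hβ, hN, e] at h ⊢
    linarith
  intro z hz
  have h := hwH z hz
  rw [hH0] at h
  exact sub_eq_zero.1 h

/-- A potential vanishing at the origin is unique. -/
theorem IsComplexPotential.eqOn {w Φ Ψ : ℂ → ℂ} (ha : 0 < a)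
    (hΦ : IsComplexPotential a ϑ w Φ) (hΨ : IsComplexPotential a ϑ w Ψ)
    (hΦ0 : Tendsto Φ (𝓝[spiralComplement a ϑ] 0) (𝓝 0))
    (hΨ0 : Tendsto Ψ (𝓝[spiralComplement a ϑ] 0) (𝓝 0)) :
    Set.EqOn Φ Ψ (spiralComplement a ϑ) := by
  intro z hz
  -- The orbit of `z` joins it to the origin inside the complement, so the constants on different
  -- components are all fixed by the limit at `0`.
  set γ : ℝ → ℂ := fun t => Complex.exp ((a + Complex.I) * t) * z with hγ
  have hγd : Differentiable ℝ γ := by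
    intro t
    have h1 : HasDerivAt (fun t : ℝ => Complex.exp ((a + Complex.I) * t)) _ t :=
      ((Complex.ofRealCLM.hasDerivAt (x := t)).const_mul ((a : ℂ) + Complex.I)).cexp
    exact (h1.mul_const z).differentiableAt
  have hd : ∀ t, HasDerivAt (fun t => Φ (γ t) - Ψ (γ t)) 0 t := by
    intro t
    have hm := exp_mul_mem_spiralComplement hz t
    have h := ((hΦ _ hm).sub (hΨ _ hm)).scomp t (hγd t).hasDerivAt
    rw [sub_self, smul_zero] at h
    exact h
  have hconst : ∀ t, Φ (γ t) - Ψ (γ t) = Φ z - Ψ z := by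
    intro t
    have h := is_const_of_deriv_eq_zero (fun t => (hd t).differentiableAt)
      (fun t => (hd t).deriv) t 0
    simpa [hγ] using h
  have hl := (hΦ0.comp (tendsto_exp_mul_nhdsWithin ha hz)).sub
    (hΨ0.comp (tendsto_exp_mul_nhdsWithin ha hz))
  have hl' : Tendsto (fun _ : ℝ => Φ z - Ψ z) atBot (𝓝 (0 - 0)) := hl.congr hconst
  have := tendsto_nhds_unique hl' tendsto_const_nhds
  rw [sub_zero] at this
  exact sub_eq_zero.1 this.symm

end Family

end LogSpirals

/-! ### Conclusion: the formulas for velocity and potential. -/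

theorem theorem8p2 (M : ℕ) (hM : 2 ≤ M) (a μ : ℝ) (ha : 0 < a) (g ϑ : Fin M → ℝ)
    (hg : ∀ m, g m ≠ 0)
    (hϑ_zero : ϑ ⟨0, by omega⟩ = 0) (hϑ_mono : StrictMono ϑ) (hϑ_lt : ∀ m, ϑ m < 2 * Real.pi)
    (w : ℂ → ℂ)
    (hw_loc : LocallyIntegrable w)
    (hw_cont : ContinuousOn w (LogSpirals.spiralComplement a ϑ))
    (hw_div : LogSpirals.WeaklyDivFree w)
    (hw_curl : LogSpirals.WeakCurlEqSpiralSheets a g ϑ w)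
    (hw_match : LogSpirals.VelocityMatching a μ ϑ w)
    (hw_decay : LogSpirals.DecayAtOrigin a ϑ w)
    (h_sys : LogSpirals.DiscreteSystem a μ g ϑ) :
    (∀ r θ : ℝ, 0 < r → (r : ℂ) * Complex.exp (θ * Complex.I) ∈ LogSpirals.spiralComplement a ϑ →
      w ((r : ℂ) * Complex.exp (θ * Complex.I)) = LogSpirals.velocityFormula a g ϑ r θ) ∧
    (∃ Φ : ℂ → ℂ, LogSpirals.IsComplexPotential a ϑ w Φ ∧
      Tendsto Φ (𝓝[LogSpirals.spiralComplement a ϑ] 0) (𝓝 0)) ∧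
    (∀ Φ : ℂ → ℂ, LogSpirals.IsComplexPotential a ϑ w Φ →
      Tendsto Φ (𝓝[LogSpirals.spiralComplement a ϑ] 0) (𝓝 0) →
      ∀ r θ : ℝ, 0 < r →
        (r : ℂ) * Complex.exp (θ * Complex.I) ∈ LogSpirals.spiralComplement a ϑ →
        Φ ((r : ℂ) * Complex.exp (θ * Complex.I)) = LogSpirals.potentialFormula a g ϑ r θ) := by
  have key := LogSpirals.conj_eq_conjVelocity ha ⟨0, by omega⟩ hw_loc hw_cont hw_div hw_curl
    hw_match
  have hpot : LogSpirals.IsComplexPotential a ϑ w (LogSpirals.spiralPotential a g ϑ) :=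
    fun z hz => by
      rw [key z hz]
      exact LogSpirals.hasDerivAt_spiralPotential ha hz
  refine ⟨fun r θ hr hz => ?_, ⟨_, hpot, LogSpirals.tendsto_spiralPotential ha⟩,
    fun Φ hΦ hΦ0 r θ hr hz => ?_⟩
  · rw [← LogSpirals.conjVelocity_polar ha hr, ← key _ hz, Complex.conj_conj]
  · rw [hΦ.eqOn ha hpot hΦ0 (LogSpirals.tendsto_spiralPotential ha) hz,
      LogSpirals.spiralPotential_polar ha hr]
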